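/- Consider a discrete memoryless cognitive interference channel with finite input alphabets $\mathcal X_1,\mathcal X_2$, finite output alphabets $\mathcal Y_1,\mathcal Y_2$ and transition probabilities $p(y_1,y_2\mid x_1,x_2)$. A code of block length $n$ at rates $R_1,R_2\ge 0$ has independent messages $M_1,M_2$, uniformly distributed on sets of sizes $\lceil 2^{nR_1}\rceil$ and $\lceil 2^{nR_2}\rceil$. The primary transmitter sends $X_1^n$, a function of $M_1$; the cognitive transmitter, who knows both messages, sends $X_2^n$, a function of $(M_1,M_2)$; and receiver $i$ estimates $M_i$ from $Y_i^n$, where the channel is used $n$ times without memory and without feedback. The pair $(R_1,R_2)$ is achievable if there are such codes for $n=0,1,2,\dots$ for which the probability that at least one receiver errs tends to $0$ as $n\to\infty$; the capacity region is the closure of the set of achievable pairs. **Theorem 1.** Suppose that the channel is cognitive-more-capable, i.e. $I(X_1,X_2;Y_2)\ge I(X_1,X_2;Y_1)$ for all input distributions $p(x_1,x_2)$. Then for every pair $(R_1,R_2)$ in the capacity region (in particular for every achievable pair) there are a random variable $U$ with finite range and a distribution $p(u,x_1,x_2)$ such that, for $(U,X_1,X_2,Y_1,Y_2)$ with joint distribution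 $p(u,x_1,x_2)\,p(y_1,y_2\mid x_1,x_2)$, $$R_1\le I(U,X_1;Y_1),$$ $$R_1+R_2\le I(U,X_1;Y_1)+I(X_2;Y_2\mid U,X_1),$$ $$R_1+R_2\le I(X_1,X_2;Y_2).$$ All mutual informations are in bits. -/

import Mathlib

open Filter Topology

noncomputable section

namespace DMCIC

/-! ### Finite probability spaces

A probability mass function on a finite type `Ω` is a point `p` of `stdSimplex ℝ Ω`; random
variables are functions on `Ω`. -/

/-- The probability of the event `s` under the mass function `p`. -/
def prob {Ω : Type*} [Fintype Ω] (p : Ω → ℝ) (s : Set Ω) : ℝ :=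
  ∑ ω, s.indicator p ω

/-- The distribution of the random variable `X`: `law p X a = P(X = a)`. -/
def law {Ω α : Type*} [Fintype Ω] (p : Ω → ℝ) (X : Ω → α) (a : α) : ℝ :=
  prob p {ω | X ω = a}

/-- Mutual information in bits,
`I(X;Y) = ∑ P(x,y) log₂ (P(x,y) / (P(x) P(y)))`; terms with `P(x,y) = 0` vanish. -/
def mutualInfo {Ω α β : Type*} [Fintype Ω] [Fintype α] [Fintype β]
    (p : Ω → ℝ) (X : Ω → α) (Y : Ω → β) : ℝ :=
  ∑ x, ∑ y, law p (fun ω => (X ω, Y ω)) (x, y) *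
    Real.logb 2 (law p (fun ω => (X ω, Y ω)) (x, y) / (law p X x * law p Y y))

/-- Conditional mutual information in bits,
`I(X;Y|Z) = ∑ P(x,y,z) log₂ (P(z) P(x,y,z) / (P(x,z) P(y,z)))`. -/
def condMutualInfo {Ω α β γ : Type*} [Fintype Ω] [Fintype α] [Fintype β] [Fintype γ]
    (p : Ω → ℝ) (X : Ω → α) (Y : Ω → β) (Z : Ω → γ) : ℝ :=
  ∑ x, ∑ y, ∑ z, law p (fun ω => (X ω, Y ω, Z ω)) (x, y, z) *
    Real.logb 2 (law p Z z * law p (fun ω => (X ω, Y ω, Z ω)) (x, y, z) /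
      (law p (fun ω => (X ω, Z ω)) (x, z) * law p (fun ω => (Y ω, Z ω)) (y, z)))

/-! ### The channel -/

/-- A two-user discrete memoryless interference channel with transition probabilities
`trans x₁ x₂ (y₁, y₂) = p(y₁, y₂ | x₁, x₂)`. -/
structure Channel (X₁ X₂ Y₁ Y₂ : Type*) [Fintype Y₁] [Fintype Y₂] where
  trans : X₁ → X₂ → Y₁ × Y₂ → ℝ
  trans_mem : ∀ x₁ x₂, trans x₁ x₂ ∈ stdSimplex ℝ (Y₁ × Y₂)

section

variable {X₁ X₂ Y₁ Y₂ : Type*} [Fintype X₁] [Fintype X₂] [Fintype Y₁] [Fintype Y₂]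

/-- The joint distribution `p(x₁,x₂) p(y₁,y₂|x₁,x₂)` of `(X₁, X₂, Y₁, Y₂)`. -/
def Channel.joint (W : Channel X₁ X₂ Y₁ Y₂) (p : X₁ × X₂ → ℝ) :
    X₁ × X₂ × Y₁ × Y₂ → ℝ :=
  fun (x₁, x₂, y₁, y₂) => p (x₁, x₂) * W.trans x₁ x₂ (y₁, y₂)

/-- The joint distribution `p(u,x₁,x₂) p(y₁,y₂|x₁,x₂)` of `(U, X₁, X₂, Y₁, Y₂)`. -/
def Channel.auxJoint {U : Type*} (W : Channel X₁ X₂ Y₁ Y₂) (p : U × X₁ × X₂ → ℝ) :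
    U × X₁ × X₂ × Y₁ × Y₂ → ℝ :=
  fun (u, x₁, x₂, y₁, y₂) => p (u, x₁, x₂) * W.trans x₁ x₂ (y₁, y₂)

/-- The channel is cognitive-more-capable: `I(X₁,X₂;Y₂) ≥ I(X₁,X₂;Y₁)` for all `p(x₁,x₂)`. -/
def Channel.CognitiveMoreCapable (W : Channel X₁ X₂ Y₁ Y₂) : Prop :=
  ∀ p ∈ stdSimplex ℝ (X₁ × X₂),
    mutualInfo (W.joint p) (fun (x₁, x₂, _, _) => (x₁, x₂)) (fun (_, _, y₁, _) => y₁) ≤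
      mutualInfo (W.joint p) (fun (x₁, x₂, _, _) => (x₁, x₂)) (fun (_, _, _, y₂) => y₂)

end

/-! ### Codes and the capacity region -/

/-- A code of block length `n` with message sets of sizes `k₁` and `k₂`. The primary transmitter 1
knows only the message `m₁`; the cognitive transmitter 2 knows both messages. -/
structure Code (X₁ X₂ Y₁ Y₂ : Type*) (k₁ k₂ n : ℕ) where
  enc₁ : Fin k₁ → Fin n → X₁
  enc₂ : Fin k₁ → Fin k₂ → Fin n → X₂
  dec₁ : (Fin n → Y₁) → Fin k₁
  dec₂ : (Fin n → Y₂) → Fin k₂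

section

variable {X₁ X₂ Y₁ Y₂ : Type*} [Fintype Y₁] [Fintype Y₂]

/-- The joint distribution of `(M₁, M₂, Y₁ⁿ, Y₂ⁿ)` when the messages are independent and uniform
and the codewords are sent over `n` uses of the memoryless channel. -/
def Code.joint {k₁ k₂ n : ℕ} (W : Channel X₁ X₂ Y₁ Y₂) (c : Code X₁ X₂ Y₁ Y₂ k₁ k₂ n) :
    Fin k₁ × Fin k₂ × (Fin n → Y₁) × (Fin n → Y₂) → ℝ :=
  fun (m₁, m₂, y₁, y₂) =>
    1 / ((k₁ : ℝ) * (k₂ : ℝ)) *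
      ∏ i, W.trans (c.enc₁ m₁ i) (c.enc₂ m₁ m₂ i) (y₁ i, y₂ i)

/-- The average probability that at least one of the two receivers decodes its message wrongly. -/
def Code.errorProb {k₁ k₂ n : ℕ} (W : Channel X₁ X₂ Y₁ Y₂) (c : Code X₁ X₂ Y₁ Y₂ k₁ k₂ n) : ℝ :=
  prob (c.joint W) {(m₁, m₂, y₁, y₂) | c.dec₁ y₁ ≠ m₁ ∨ c.dec₂ y₂ ≠ m₂}

/-- `(R₁, R₂)` is achievable: there are codes with `⌈2 ^ (n R₁)⌉` and `⌈2 ^ (n R₂)⌉` messages and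
block length `n = 0, 1, 2, …` whose error probability tends to `0`. -/
def Channel.Achievable (W : Channel X₁ X₂ Y₁ Y₂) (R : ℝ × ℝ) : Prop :=
  0 ≤ R.1 ∧ 0 ≤ R.2 ∧
    ∃ c : ∀ n : ℕ, Code X₁ X₂ Y₁ Y₂ ⌈(2 : ℝ) ^ ((n : ℝ) * R.1)⌉₊ ⌈(2 : ℝ) ^ ((n : ℝ) * R.2)⌉₊ n,
      Tendsto (fun n => (c n).errorProb W) atTop (𝓝 0)

/-- The capacity region: the closure of the set of achievable rate pairs. -/
def Channel.capacityRegion (W : Channel X₁ X₂ Y₁ Y₂) : Set (ℝ × ℝ) :=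
  closure {R | W.Achievable R}

end

/-! ### The outer bound -/

/-- The rate pairs that satisfy
`R₁ ≤ I(U,X₁;Y₁)`, `R₁ + R₂ ≤ I(U,X₁;Y₁) + I(X₂;Y₂|U,X₁)` and `R₁ + R₂ ≤ I(X₁,X₂;Y₂)`
for some distribution `p(u,x₁,x₂) p(y₁,y₂|x₁,x₂)` with an auxiliary variable `U` of finite
range. -/
def Channel.outerRegion {X₁ X₂ Y₁ Y₂ : Type*} [Fintype X₁] [Fintype X₂] [Fintype Y₁] [Fintype Y₂]
    (W : Channel X₁ X₂ Y₁ Y₂) : Set (ℝ × ℝ) :=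
  {R | 0 ≤ R.1 ∧ 0 ≤ R.2 ∧
    ∃ (m : ℕ) (p : Fin m × X₁ × X₂ → ℝ), p ∈ stdSimplex ℝ (Fin m × X₁ × X₂) ∧
      R.1 ≤ mutualInfo (W.auxJoint p)
        (fun (u, x₁, _, _, _) => (u, x₁)) (fun (_, _, _, y₁, _) => y₁) ∧
      R.1 + R.2 ≤
        mutualInfo (W.auxJoint p)
          (fun (u, x₁, _, _, _) => (u, x₁)) (fun (_, _, _, y₁, _) => y₁) +
        condMutualInfo (W.auxJoint p)
          (fun (_, _, x₂, _, _) => x₂) (fun (_, _, _, _, y₂) => y₂)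
          (fun (u, x₁, _, _, _) => (u, x₁)) ∧
      R.1 + R.2 ≤ mutualInfo (W.auxJoint p)
        (fun (_, x₁, x₂, _, _) => (x₁, x₂)) (fun (_, _, _, _, y₂) => y₂)}

end DMCIC

end

/-! The auxiliary variable at time i is U_i = (M₁, Y₁^{i-1}, Y₂ᵢ₊₁ⁿ), which determines X₁ᵢ. Fano's
inequality bounds nR₁ by I(M₁;Y₁ⁿ), and n(R₁+R₂) both by I(M₁;Y₁ⁿ) + I(M₂;Y₂ⁿ|M₁) and by I(M₂;Y₂ⁿ) +
I(M₁;Y₁ⁿ|M₂), up to o(n). The Csiszár sum identity `sum_ent_sub_ent` turns H(Y₂ⁿ|M₁) - H(Y₁ⁿ|M₁)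
into a sum of single-letter differences given U_i, which yields the first sum-rate bound. For the
second, the same identity is used with M₂ in place of M₁. Being more capable, conditionally on (M₂,
Y₁^{i-1}, Y₂ᵢ₊₁ⁿ), then allows Y₁ᵢ to be replaced by Y₂ᵢ.

The bounds involve only the input law q and the two conditional entropies H(Y₁|U,X₁), H(Y₂|U,X₁).
The triples that occur form the convex hull of a compact curve on which X₁ is constant; U indexes
the convex combination. Averaging over time stays in the hull (`Code.exists_bounds`). Carathéodory's
theorem makes the hull compact and bounds the range of U, so the region is closed
(`Channel.isClosed_signedRegion`) and survives both n → ∞ and the closure in the capacity region.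
`Channel.mem_outerRegion` turns a hull point back into a distribution p(u,x₁,x₂). -/

noncomputable section

namespace DMCIC

/-! ### Entropy of random variables on a finite probability space -/

section Entropy

variable {Ω α β γ : Type*} [Fintype Ω]

/-- Entropy in nats, as the expectation of `-log P(X)`. -/
def ent (p : Ω → ℝ) (X : Ω → α) : ℝ :=
  -∑ ω, p ω * Real.log (law p X (X ω))

open Classical in
theorem prob_eq_sum (p : Ω → ℝ) (s : Set Ω) : prob p s = ∑ ω, if ω ∈ s then p ω else 0 := by
  simp only [prob, Set.indicator_apply]

open Classical in
theorem law_eq_sum (p : Ω → ℝ) (X : Ω → α) (a : α) :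
    law p X a = ∑ ω, if X ω = a then p ω else 0 := by
  rw [law, prob_eq_sum]
  exact Finset.sum_congr rfl fun ω _ => by simp

theorem law_nonneg {p : Ω → ℝ} (hp : ∀ ω, 0 ≤ p ω) (X : Ω → α) (a : α) : 0 ≤ law p X a := by
  classical
  rw [law_eq_sum]
  exact Finset.sum_nonneg fun ω _ => by split_ifs <;> simp [hp]

theorem sum_law_mul [Fintype α] (p : Ω → ℝ) (X : Ω → α) (f : α → ℝ) :
    ∑ a, law p X a * f a = ∑ ω, p ω * f (X ω) := by
  classical
  simp only [law_eq_sum, Finset.sum_mul]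
  rw [Finset.sum_comm]
  simp [ite_mul]

theorem sum_law [Fintype α] (p : Ω → ℝ) (X : Ω → α) : ∑ a, law p X a = ∑ ω, p ω := by
  simpa using sum_law_mul p X fun _ => 1

theorem sum_law_fst [Fintype α] (p : Ω → ℝ) (X : Ω → α) (Z : Ω → γ) (z : γ) :
    ∑ x, law p (fun ω => (X ω, Z ω)) (x, z) = law p Z z := by
  classical
  simp only [law_eq_sum, Prod.mk.injEq]
  rw [Finset.sum_comm]
  refine Finset.sum_congr rfl fun ω _ => ?_
  by_cases h : Z ω = z <;> simp [h]

theorem law_congr (p : Ω → ℝ) {X : Ω → α} {Y : Ω → β} {a : α} {b : β}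
    (h : ∀ ω, X ω = a ↔ Y ω = b) : law p X a = law p Y b := by
  simp only [law, h]

theorem sum_law_snd [Fintype γ] (p : Ω → ℝ) (X : Ω → α) (Z : Ω → γ) (x : α) :
    ∑ z, law p (fun ω => (X ω, Z ω)) (x, z) = law p X x := by
  rw [← sum_law_fst p Z X x]
  exact Finset.sum_congr rfl fun z _ => law_congr p fun ω => by simp [and_comm]

theorem ent_eq_sum [Fintype α] (p : Ω → ℝ) (X : Ω → α) :
    ent p X = ∑ a, Real.negMulLog (law p X a) := by
  rw [ent, ← sum_law_mul p X fun a => Real.log (law p X a), ← Finset.sum_neg_distrib]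
  simp [Real.negMulLog]

/-- Entropy sees only the partition of `Ω` into fibres. Every reordering of tuples, and every
removal of a redundant coordinate, rests on this. -/
theorem ent_congr (p : Ω → ℝ) {X : Ω → α} {Y : Ω → β}
    (h : ∀ ω ω', X ω = X ω' ↔ Y ω = Y ω') : ent p X = ent p Y := by
  simp only [ent, law_congr p fun ω' => h ω' _]

theorem ent_of_const {p : Ω → ℝ} (hp : ∑ ω, p ω = 1) {X : Ω → α} (h : ∀ ω ω', X ω = X ω') :
    ent p X = 0 := by
  have (ω : Ω) : law p X (X ω) = 1 := by
    classical
    rw [law_eq_sum, ← hp]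
    exact Finset.sum_congr rfl fun ω' _ => by simp [h ω' ω]
  simp [ent, this]

theorem law_map_pos {p : Ω → ℝ} (hp : ∀ ω, 0 ≤ p ω) {X : Ω → α} (f : α → β) {a : α}
    (h : law p X a ≠ 0) : 0 < law p (fun ω => f (X ω)) (f a) := by
  classical
  refine lt_of_lt_of_le ((law_nonneg hp X a).lt_of_ne' h) ?_
  rw [law_eq_sum, law_eq_sum]
  refine Finset.sum_le_sum fun ω _ => ?_
  by_cases h : X ω = a
  · simp [h]
  · rw [if_neg h]; split_ifs <;> simp [hp]

/-- Gibbs' inequality. -/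
theorem sum_law_mul_log_le [Fintype α] {p : Ω → ℝ} (hp : ∀ ω, 0 ≤ p ω) (X : Ω → α) {Q : α → ℝ}
    (hQ : ∀ a, 0 ≤ Q a) (hQ' : ∀ a, law p X a ≠ 0 → 0 < Q a) (hs : ∑ a, Q a ≤ ∑ ω, p ω) :
    ∑ a, law p X a * Real.log (Q a) ≤ -ent p X := by
  rw [ent_eq_sum, ← Finset.sum_neg_distrib]
  have : ∑ a, (law p X a * Real.log (Q a) - -Real.negMulLog (law p X a)) ≤
      ∑ a, (Q a - law p X a) := by
    refine Finset.sum_le_sum fun a _ => ?_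
    by_cases h : law p X a = 0
    · simp [h, hQ]
    have h0 := (law_nonneg hp X a).lt_of_ne' h
    have h1 := Real.log_le_sub_one_of_pos (div_pos (hQ' a h) h0)
    rw [Real.log_div (hQ' a h).ne' h] at h1
    have h2 := mul_le_mul_of_nonneg_left h1 h0.le
    rw [mul_sub, mul_sub, mul_div_cancel₀ _ h] at h2
    simp only [Real.negMulLog]
    linarith
  rw [Finset.sum_sub_distrib, Finset.sum_sub_distrib, sum_law] at this
  linarith

/-- Gibbs' inequality against P(x,z)P(y,z)/P(z), the law that makes `X` and `Y` conditionally
independent given `Z`. This is I(X;Y|Z) ≥ 0, i.e. conditioning reduces entropy. -/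
theorem ent_submodular [Fintype α] [Fintype β] [Fintype γ] {p : Ω → ℝ} (hp : ∀ ω, 0 ≤ p ω)
    (X : Ω → α) (Y : Ω → β) (Z : Ω → γ) :
    ent p (fun ω => (X ω, Y ω, Z ω)) + ent p Z ≤
      ent p (fun ω => (X ω, Z ω)) + ent p (fun ω => (Y ω, Z ω)) := by
  set T : Ω → α × β × γ := fun ω => (X ω, Y ω, Z ω)
  set Q : α × β × γ → ℝ := fun t => law p (fun ω => (X ω, Z ω)) (t.1, t.2.2) *
    law p (fun ω => (Y ω, Z ω)) (t.2.1, t.2.2) / law p Z t.2.2 with hQdef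
  have pos1 (t) (h : law p T t ≠ 0) : 0 < law p (fun ω => (X ω, Z ω)) (t.1, t.2.2) :=
    law_map_pos hp (X := T) (fun t => (t.1, t.2.2)) h
  have pos2 (t) (h : law p T t ≠ 0) : 0 < law p (fun ω => (Y ω, Z ω)) (t.2.1, t.2.2) :=
    law_map_pos hp (X := T) (fun t => (t.2.1, t.2.2)) h
  have pos3 (t) (h : law p T t ≠ 0) : 0 < law p Z t.2.2 :=
    law_map_pos hp (X := T) (fun t => t.2.2) h
  have key := sum_law_mul_log_le hp T (Q := Q)
    (fun t => div_nonneg (mul_nonneg (law_nonneg hp _ _) (law_nonneg hp _ _)) (law_nonneg hp _ _))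
    (fun t h => div_pos (mul_pos (pos1 t h) (pos2 t h)) (pos3 t h)) (by
      rw [← sum_law p Z, Fintype.sum_prod_type, Finset.sum_congr rfl fun x _ =>
        Fintype.sum_prod_type _, Finset.sum_congr rfl fun x _ => Finset.sum_comm, Finset.sum_comm]
      refine (Finset.sum_congr rfl fun z _ => ?_).le
      simp only [hQdef, ← Finset.sum_div, ← Finset.mul_sum, sum_law_fst, ← Finset.sum_mul]
      exact mul_self_div_self _)
  have : ∑ t, law p T t * Real.log (Q t) =
      ∑ t, law p T t * (Real.log (law p (fun ω => (X ω, Z ω)) (t.1, t.2.2)) +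
        Real.log (law p (fun ω => (Y ω, Z ω)) (t.2.1, t.2.2)) - Real.log (law p Z t.2.2)) := by
    refine Finset.sum_congr rfl fun t _ => ?_
    by_cases h : law p T t = 0
    · simp [h]
    rw [Real.log_div (mul_pos (pos1 t h) (pos2 t h)).ne' (pos3 t h).ne',
      Real.log_mul (pos1 t h).ne' (pos2 t h).ne']
  rw [this, sum_law_mul] at key
  simp only [mul_sub, mul_add, Finset.sum_sub_distrib, Finset.sum_add_distrib] at key
  simp only [ent] at key ⊢
  linarith

/-- Fano's inequality. -/
theorem ent_sub_ent_le [Fintype α] [Fintype β] {p : Ω → ℝ} (hp : ∀ ω, 0 ≤ p ω)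
    (hp1 : ∑ ω, p ω = 1) (X : Ω → α) (Y : Ω → β) (dec : β → α) :
    ent p (fun ω => (X ω, Y ω)) - ent p Y ≤
      Real.log 2 + prob p {ω | dec (Y ω) ≠ X ω} * Real.log (Fintype.card α) := by
  classical
  have hne : Nonempty Ω := by
    by_contra h
    rw [not_nonempty_iff] at h
    simp at hp1
  have : Nonempty α := ⟨X hne.some⟩
  have hk : (0 : ℝ) < Fintype.card α := by exact_mod_cast Fintype.card_pos
  set k : ℝ := (Fintype.card α : ℝ) with hkdef
  -- The comparison law for Gibbs guesses `X` from `Y` by an equal mixture of the decoder's answer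
  -- and a uniform guess. A correct decision then costs at most log 2, a wrong one log 2 + log k.
  set r : α × β → ℝ := fun t => ((if dec t.2 = t.1 then 1 else 0) + 1 / k) / 2 with hr
  have hr0 (t) : 0 < r t := by
    have : 0 < 1 / k := by positivity
    simp only [hr]; split_ifs <;> linarith
  set T : Ω → α × β := fun ω => (X ω, Y ω)
  have pos (t) (h : law p T t ≠ 0) : 0 < law p Y t.2 := law_map_pos hp (X := T) Prod.snd h
  have key := sum_law_mul_log_le hp T (Q := fun t => law p Y t.2 * r t)
    (fun t => mul_nonneg (law_nonneg hp _ _) (hr0 t).le)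
    (fun t h => mul_pos (pos t h) (hr0 t)) (by
      rw [← sum_law p Y, Fintype.sum_prod_type, Finset.sum_comm]
      refine (Finset.sum_congr rfl fun y _ => ?_).le
      simp only [hr, ← Finset.mul_sum, ← Finset.sum_div, Finset.sum_add_distrib, Finset.sum_ite_eq,
        Finset.mem_univ, if_true, Finset.sum_const, Finset.card_univ, nsmul_eq_mul, ← hkdef]
      field_simp
      norm_num)
  have : ∑ t, law p T t * Real.log (law p Y t.2 * r t) =
      ∑ t, law p T t * (Real.log (law p Y t.2) + Real.log (r t)) := by
    refine Finset.sum_congr rfl fun t _ => ?_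
    by_cases h : law p T t = 0
    · simp [h]
    rw [Real.log_mul (pos t h).ne' (hr0 t).ne']
  rw [this, sum_law_mul] at key
  simp only [mul_add, Finset.sum_add_distrib] at key
  have hlog : -(∑ ω, p ω * Real.log (r (T ω))) ≤
      Real.log 2 + prob p {ω | dec (Y ω) ≠ X ω} * Real.log k := by
    rw [prob_eq_sum, Finset.sum_mul, ← one_mul (Real.log 2), ← hp1, Finset.sum_mul,
      ← Finset.sum_add_distrib, ← Finset.sum_neg_distrib]
    refine Finset.sum_le_sum fun ω _ => ?_
    rw [← mul_neg]
    by_cases h : dec (Y ω) = X ω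
    · have : -Real.log 2 ≤ Real.log (r (T ω)) := by
        rw [← Real.log_inv]
        refine Real.log_le_log (by norm_num) ?_
        have : 0 < 1 / k := by positivity
        simp only [hr, T, h, if_true]; linarith
      have := mul_le_mul_of_nonneg_left this (hp ω)
      simp [h]; linarith
    · have : Real.log (r (T ω)) = -Real.log 2 - Real.log k := by
        simp only [hr, T, h, if_false]
        rw [zero_add, Real.log_div (by positivity) (by norm_num), Real.log_div one_ne_zero hk.ne']
        simp; ring
      simp [h, this]; linarith
  simp only [ent] at key ⊢
  linarith

theorem mutualInfo_eq_ent [Fintype α] [Fintype β] {p : Ω → ℝ} (hp : ∀ ω, 0 ≤ p ω)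
    (X : Ω → α) (Y : Ω → β) :
    mutualInfo p X Y = (ent p X + ent p Y - ent p (fun ω => (X ω, Y ω))) / Real.log 2 := by
  set T : Ω → α × β := fun ω => (X ω, Y ω)
  have : mutualInfo p X Y = (∑ t, law p T t * (Real.log (law p T t) -
      Real.log (law p X t.1) - Real.log (law p Y t.2))) / Real.log 2 := by
    rw [Fintype.sum_prod_type, mutualInfo, Finset.sum_div]
    refine Finset.sum_congr rfl fun x _ => ?_
    rw [Finset.sum_div]
    refine Finset.sum_congr rfl fun y _ => ?_
    by_cases h : law p T (x, y) = 0
    · simp [h, T]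
    have h1 : 0 < law p X x := law_map_pos hp (X := T) Prod.fst h
    have h2 : 0 < law p Y y := law_map_pos hp (X := T) Prod.snd h
    rw [Real.logb, Real.log_div h (mul_pos h1 h2).ne', Real.log_mul h1.ne' h2.ne']
    ring
  rw [this, sum_law_mul]
  simp only [mul_sub, Finset.sum_sub_distrib, ent]
  congr 1; ring

theorem condMutualInfo_eq_ent [Fintype α] [Fintype β] [Fintype γ] {p : Ω → ℝ}
    (hp : ∀ ω, 0 ≤ p ω) (X : Ω → α) (Y : Ω → β) (Z : Ω → γ) :
    condMutualInfo p X Y Z = (ent p (fun ω => (X ω, Z ω)) + ent p (fun ω => (Y ω, Z ω)) -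
      ent p Z - ent p (fun ω => (X ω, Y ω, Z ω))) / Real.log 2 := by
  set T : Ω → α × β × γ := fun ω => (X ω, Y ω, Z ω)
  have : condMutualInfo p X Y Z = (∑ t, law p T t * (Real.log (law p Z t.2.2) +
      Real.log (law p T t) - Real.log (law p (fun ω => (X ω, Z ω)) (t.1, t.2.2)) -
      Real.log (law p (fun ω => (Y ω, Z ω)) (t.2.1, t.2.2)))) / Real.log 2 := by
    rw [Fintype.sum_prod_type, condMutualInfo, Finset.sum_div]
    refine Finset.sum_congr rfl fun x _ => ?_
    rw [Fintype.sum_prod_type, Finset.sum_div]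
    refine Finset.sum_congr rfl fun y _ => ?_
    rw [Finset.sum_div]
    refine Finset.sum_congr rfl fun z _ => ?_
    by_cases h : law p T (x, y, z) = 0
    · simp [h, T]
    have h1 : 0 < law p (fun ω => (X ω, Z ω)) (x, z) :=
      law_map_pos hp (X := T) (fun t => (t.1, t.2.2)) h
    have h2 : 0 < law p (fun ω => (Y ω, Z ω)) (y, z) :=
      law_map_pos hp (X := T) (fun t => (t.2.1, t.2.2)) h
    have h3 : 0 < law p Z z := law_map_pos hp (X := T) (fun t => t.2.2) h
    rw [Real.logb, Real.log_div (mul_ne_zero h3.ne' h) (mul_pos h1 h2).ne',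
      Real.log_mul h1.ne' h2.ne', Real.log_mul h3.ne' h]
    ring
  rw [this, sum_law_mul]
  simp only [mul_sub, mul_add, Finset.sum_sub_distrib, Finset.sum_add_distrib, ent]
  congr 1; ring

end Entropy

/-! ### Variables observed through a stochastic kernel -/

section Kernel

variable {Ω α β γ : Type*} [Fintype Ω]

/-- The output distribution of the kernel `K` for the input distribution `q`. -/
def out [Fintype α] (K : α → β → ℝ) (q : α → ℝ) (y : β) : ℝ := ∑ x, q x * K x y

/-- The entropy (in nats) of the output of the kernel `K` for the input distribution `q`. -/
def outEnt [Fintype α] [Fintype β] (K : α → β → ℝ) (q : α → ℝ) : ℝ :=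
  ∑ y, Real.negMulLog (out K q y)

/-- The entropy (in nats) of the output of the kernel `K` for the fixed input `x`. -/
def noiseEnt [Fintype β] (K : α → β → ℝ) (x : α) : ℝ := ∑ y, Real.negMulLog (K x y)

/-- Given `(V, X)`, the variable `Y` is distributed according to `K X`. -/
def IsOutput (p : Ω → ℝ) (K : α → β → ℝ) (V : Ω → γ) (X : Ω → α) (Y : Ω → β) : Prop :=
  ∀ v x y, law p (fun ω => (V ω, X ω, Y ω)) (v, x, y) = law p (fun ω => (V ω, X ω)) (v, x) * K x y

/-- The conditional distribution of `X` given `V = v`. -/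
def condLaw (p : Ω → ℝ) (V : Ω → γ) (X : Ω → α) (v : γ) (x : α) : ℝ :=
  law p (fun ω => (V ω, X ω)) (v, x) / law p V v

/-- The coordinate `a` holds everything but the channel letter `b`. As `V` does not see `b`, the
letter sums out through `k (ξ a)`. All Markov conditions of the proof come from here; the weight `r`
need not be normalised. -/
theorem isOutput_of_equiv {A B : Type*} [Fintype A] [Fintype B] (e : A × B ≃ Ω) {p : Ω → ℝ}
    {r : A → ℝ} {ξ : A → α} {k : α → B → ℝ} (hk : ∀ x, ∑ b, k x b = 1)
    (hp : ∀ a b, p (e (a, b)) = r a * k (ξ a) b) {V : Ω → γ} {X : Ω → α} {Y : Ω → β} (g : B → β)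
    (hV : ∀ a b b', V (e (a, b)) = V (e (a, b'))) (hX : ∀ a b, X (e (a, b)) = ξ a)
    (hY : ∀ a b, Y (e (a, b)) = g b) : IsOutput p (fun x => law (k x) g) V X Y := by
  classical
  intro v x y
  simp only [law_eq_sum, ← Equiv.sum_comp e, Fintype.sum_prod_type, Prod.mk.injEq, hX, hY, hp]
  rw [Finset.sum_mul]
  refine Finset.sum_congr rfl fun a _ => ?_
  rcases isEmpty_or_nonempty B with hB | ⟨⟨b₀⟩⟩
  · simp
  simp only [hV a _ b₀]
  by_cases h : V (e (a, b₀)) = v ∧ ξ a = x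
  · simp only [h.1, h.2, true_and, and_self, if_true, ← Finset.mul_sum, hk, mul_one]
    simp only [Finset.mul_sum, mul_ite, mul_zero]
  · simp only [← and_assoc, h, false_and, if_false, Finset.sum_const_zero, zero_mul]

variable {p : Ω → ℝ} {K : α → β → ℝ} {V : Ω → γ}
  {X : Ω → α} {Y : Ω → β}

theorem law_mul_condLaw (hp : ∀ ω, 0 ≤ p ω) (v : γ) (x : α) :
    law p V v * condLaw p V X v x = law p (fun ω => (V ω, X ω)) (v, x) := by
  by_cases h : law p V v = 0
  · rw [h, zero_mul]
    by_contra h'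
    exact (law_map_pos hp (X := fun ω => (V ω, X ω)) Prod.fst (Ne.symm h')).ne' h
  · rw [condLaw, mul_div_cancel₀ _ h]

theorem sum_law_mul_condLaw [Fintype γ] (hp : ∀ ω, 0 ≤ p ω) (x : α) :
    ∑ v, law p V v * condLaw p V X v x = law p X x := by
  simp only [law_mul_condLaw hp, sum_law_fst]

variable [Fintype α]

theorem condLaw_mem (hp : ∀ ω, 0 ≤ p ω) {v : γ} (h : law p V v ≠ 0) :
    condLaw p V X v ∈ stdSimplex ℝ α := by
  refine ⟨fun x => div_nonneg (law_nonneg hp _ _) (law_nonneg hp _ _), ?_⟩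
  simp only [condLaw, ← Finset.sum_div, sum_law_snd, div_self h]

theorem IsOutput.law_eq (h : IsOutput p K V X Y) (v : γ) (y : β) :
    law p (fun ω => (V ω, Y ω)) (v, y) = ∑ x, law p (fun ω => (V ω, X ω)) (v, x) * K x y := by
  simp only [← h v _ y]
  rw [← sum_law_fst p X (fun ω => (V ω, Y ω)) (v, y)]
  exact Finset.sum_congr rfl fun x _ => law_congr p fun ω => by simp; tauto

theorem IsOutput.law_out [Fintype γ] (h : IsOutput p K V X Y) (y : β) : law p Y y = out K (law p X) y := by
  rw [← sum_law_fst p V Y y, out]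
  simp only [h.law_eq]
  rw [Finset.sum_comm]
  simp only [← Finset.sum_mul, sum_law_fst]

variable [Fintype β]

theorem sum_out (hK : ∀ x, ∑ y, K x y = 1) (q : α → ℝ) : ∑ y, out K q y = ∑ x, q x := by
  simp only [out]
  rw [Finset.sum_comm]
  simp [← Finset.mul_sum, hK]

/-- The output law is linear in the input law, and -t log t is concave. -/
theorem outEnt_concave (hK : ∀ x y, 0 ≤ K x y) {ι : Type*} [Fintype ι] {w : ι → ℝ}
    (hw : ∀ i, 0 ≤ w i) (hw1 : ∑ i, w i = 1) {q : ι → α → ℝ} (hq : ∀ i x, 0 ≤ q i x) :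
    ∑ i, w i * outEnt K (q i) ≤ outEnt K (∑ i, w i • q i) := by
  simp only [outEnt, Finset.mul_sum]
  rw [Finset.sum_comm]
  refine Finset.sum_le_sum fun y _ => ?_
  have := Real.concaveOn_negMulLog.le_map_sum (t := Finset.univ) (w := w)
    (p := fun i => out K (q i) y) (fun i _ => hw i) hw1
    (fun i _ => Finset.sum_nonneg fun x _ => mul_nonneg (hq i x) (hK x y))
  refine this.trans_eq (congrArg _ ?_)
  simp only [out, smul_eq_mul, Finset.mul_sum, Finset.sum_apply, Pi.smul_apply, Finset.sum_mul]
  rw [Finset.sum_comm]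
  simp only [mul_assoc]

theorem continuous_outEnt : Continuous (outEnt K) := by
  unfold outEnt out
  exact continuous_finsetSum _ fun y _ => Real.continuous_negMulLog.comp (by fun_prop)

variable [Fintype γ]

/-- H(Y|V,X) = H(Y|X): the noise entropy depends only on the law of `X`. -/
theorem IsOutput.ent_eq (h : IsOutput p K V X Y) (hK : ∀ x, ∑ y, K x y = 1) :
    ent p (fun ω => (V ω, X ω, Y ω)) =
      ent p (fun ω => (V ω, X ω)) + ∑ x, law p X x * noiseEnt K x := by
  have : ∑ x, law p X x * noiseEnt K x =
      ∑ v, ∑ x, law p (fun ω => (V ω, X ω)) (v, x) * noiseEnt K x := by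
    rw [Finset.sum_comm]
    simp only [← Finset.sum_mul, sum_law_fst]
  rw [this, ent_eq_sum, ent_eq_sum, Fintype.sum_prod_type, Fintype.sum_prod_type,
    ← Finset.sum_add_distrib]
  refine Finset.sum_congr rfl fun v _ => ?_
  rw [Fintype.sum_prod_type, ← Finset.sum_add_distrib]
  refine Finset.sum_congr rfl fun x _ => ?_
  simp only [h v x, Real.negMulLog_mul, Finset.sum_add_distrib, ← Finset.sum_mul, hK, one_mul,
    ← Finset.mul_sum, noiseEnt]

theorem IsOutput.ent_out (h : IsOutput p K V X Y) : ent p Y = outEnt K (law p X) := by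
  simp only [ent_eq_sum, h.law_out, outEnt]

theorem IsOutput.ent_prod_eq (h : IsOutput p K V X Y) (hp : ∀ ω, 0 ≤ p ω)
    (hK : ∀ x, ∑ y, K x y = 1) :
    ent p (fun ω => (V ω, Y ω)) = ent p V + ∑ v, law p V v * outEnt K (condLaw p V X v) := by
  have hl (v y) : law p (fun ω => (V ω, Y ω)) (v, y) =
      law p V v * out K (condLaw p V X v) y := by
    simp only [h.law_eq, out, Finset.mul_sum, ← mul_assoc, law_mul_condLaw hp]
  rw [ent_eq_sum, ent_eq_sum, Fintype.sum_prod_type, ← Finset.sum_add_distrib]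
  refine Finset.sum_congr rfl fun v _ => ?_
  simp only [hl, Real.negMulLog_mul, Finset.sum_add_distrib, ← Finset.sum_mul, ← Finset.mul_sum,
    sum_out hK, outEnt]
  by_cases h0 : law p V v = 0
  · simp [h0]
  · rw [(condLaw_mem hp h0).2, one_mul]

end Kernel

/-! ### Convex hulls in finite dimension -/

/-- Membership is asked only where the weight is nonzero, because conditional laws given null events
are not probability vectors. -/
theorem sum_smul_mem_convexHull {ι E : Type*} [Fintype ι] [AddCommGroup E] [Module ℝ E]
    {s : Set E} {w : ι → ℝ} {z : ι → E} (hw : ∀ i, 0 ≤ w i) (hw1 : ∑ i, w i = 1)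
    (hz : ∀ i, w i ≠ 0 → z i ∈ s) : ∑ i, w i • z i ∈ convexHull ℝ s := by
  classical
  have h : ∑ i, w i • z i = ∑ i with w i ≠ 0, w i • z i := by
    rw [Finset.sum_filter_of_ne]
    intro i _ h h0
    simp [h0] at h
  rw [h]
  refine (convex_convexHull ℝ s).sum_mem (fun i _ => hw i) ?_ fun i hi =>
    subset_convexHull ℝ s (hz i (Finset.mem_filter.1 hi).2)
  rw [← hw1, Finset.sum_filter_ne_zero]

/-- Points of a convex hull in finite dimension are convex combinations of a fixed number of
points. -/
theorem exists_fin_of_mem_convexHull {E : Type*} [AddCommGroup E] [Module ℝ E]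
    [FiniteDimensional ℝ E] {s : Set E} {x : E} (hx : x ∈ convexHull ℝ s) :
    ∃ w ∈ stdSimplex ℝ (Fin (Module.finrank ℝ E + 1)), ∃ z : Fin (Module.finrank ℝ E + 1) → E,
      (∀ i, z i ∈ s) ∧ ∑ i, w i • z i = x := by
  obtain ⟨ι, _, z, w, hz, hind, hw, hw1, hx'⟩ := eq_pos_convex_span_of_mem_convexHull hx
  obtain ⟨z₀, hz₀⟩ := convexHull_nonempty_iff.1 ⟨x, hx⟩
  have hcard : Fintype.card ι ≤ Fintype.card (Fin (Module.finrank ℝ E + 1)) := by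
    rw [Fintype.card_fin]
    exact hind.card_le_finrank_succ.trans (Nat.succ_le_succ (Submodule.finrank_le _))
  obtain ⟨e⟩ := Function.Embedding.nonempty_of_card_le hcard
  have hout (j) (hj : j ∉ Set.range e) : Function.extend e w 0 j = 0 :=
    Function.extend_apply' _ _ _ hj
  -- Carathéodory's points are padded to the full number: the spare indices get weight 0 and the
  -- arbitrary point `z₀`.
  refine ⟨Function.extend e w 0, ⟨fun j => ?_, ?_⟩, Function.extend e z fun _ => z₀,
    fun j => ?_, ?_⟩
  · by_cases hj : j ∈ Set.range e
    · obtain ⟨i, rfl⟩ := hj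
      rw [e.injective.extend_apply]; exact (hw i).le
    · exact (hout j hj).ge
  · rw [← hw1]
    exact (Fintype.sum_of_injective e e.injective _ _ hout
      fun i => (e.injective.extend_apply w 0 i).symm).symm
  · by_cases hj : j ∈ Set.range e
    · obtain ⟨i, rfl⟩ := hj
      rw [e.injective.extend_apply]; exact hz ⟨i, rfl⟩
    · rwa [Function.extend_apply' _ _ _ hj]
  · rw [← hx']
    refine (Fintype.sum_of_injective e e.injective _ _ (fun j hj => ?_) fun i => ?_).symm
    · rw [hout j hj, zero_smul]
    · rw [e.injective.extend_apply, e.injective.extend_apply]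

theorem isCompact_convexHull {E : Type*} [NormedAddCommGroup E] [NormedSpace ℝ E]
    [FiniteDimensional ℝ E] {s : Set E} (hs : IsCompact s) : IsCompact (convexHull ℝ s) := by
  have : convexHull ℝ s = (fun t : (Fin (Module.finrank ℝ E + 1) → ℝ) ×
      (Fin (Module.finrank ℝ E + 1) → E) => ∑ i, t.1 i • t.2 i) ''
        (stdSimplex ℝ _ ×ˢ Set.univ.pi fun _ => s) := by
    ext x
    constructor
    · intro hx
      obtain ⟨w, hw, z, hz, h⟩ := exists_fin_of_mem_convexHull hx
      exact ⟨(w, z), ⟨hw, fun i _ => hz i⟩, h⟩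
    · rintro ⟨⟨w, z⟩, ⟨hw, hz⟩, rfl⟩
      exact sum_smul_mem_convexHull hw.1 hw.2 fun i _ => hz i trivial
  rw [this]
  exact ((isCompact_stdSimplex ℝ _).prod (isCompact_univ_pi fun _ => hs)).image (by fun_prop)

/-! ### The outer region in terms of the marginal channels -/

section Region

variable {X₁ X₂ Y₁ Y₂ : Type*} [Fintype Y₁] [Fintype Y₂]

/-- The marginal channel `p(y₁|x₁,x₂)`. -/
def Channel.fst (W : Channel X₁ X₂ Y₁ Y₂) (x : X₁ × X₂) : Y₁ → ℝ :=
  law (W.trans x.1 x.2) Prod.fst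

/-- The marginal channel `p(y₂|x₁,x₂)`. -/
def Channel.snd (W : Channel X₁ X₂ Y₁ Y₂) (x : X₁ × X₂) : Y₂ → ℝ :=
  law (W.trans x.1 x.2) Prod.snd

variable (W : Channel X₁ X₂ Y₁ Y₂)

theorem Channel.sum_fst (x : X₁ × X₂) : ∑ y, W.fst x y = 1 :=
  (sum_law _ _).trans (W.trans_mem _ _).2

theorem Channel.sum_snd (x : X₁ × X₂) : ∑ y, W.snd x y = 1 :=
  (sum_law _ _).trans (W.trans_mem _ _).2

theorem Channel.fst_nonneg (x : X₁ × X₂) (y : Y₁) : 0 ≤ W.fst x y :=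
  law_nonneg (W.trans_mem _ _).1 _ _

theorem Channel.snd_nonneg (x : X₁ × X₂) (y : Y₂) : 0 ≤ W.snd x y :=
  law_nonneg (W.trans_mem _ _).1 _ _

variable [Fintype X₁] [Fintype X₂]

/-- The points `(q, H(Y₁), H(Y₂))` for the input distributions `q` with deterministic `X₁`. -/
def Channel.entropyCurve : Set ((X₁ × X₂ → ℝ) × ℝ × ℝ) :=
  (fun q => (q, outEnt W.fst q, outEnt W.snd q)) ''
    {q | q ∈ stdSimplex ℝ (X₁ × X₂) ∧ ∃ ξ, ∀ x : X₁ × X₂, x.1 ≠ ξ → q x = 0}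

/-- Since the alphabet of X₁ is finite, constancy of X₁ is a finite union of closed conditions; the
entropies are continuous. -/
theorem Channel.isCompact_entropyCurve : IsCompact W.entropyCurve := by
  refine IsCompact.image ?_ (continuous_id.prodMk (continuous_outEnt.prodMk continuous_outEnt))
  have : {q : X₁ × X₂ → ℝ | q ∈ stdSimplex ℝ (X₁ × X₂) ∧ ∃ ξ, ∀ x : X₁ × X₂, x.1 ≠ ξ → q x = 0} =
      stdSimplex ℝ (X₁ × X₂) ∩
        ⋃ ξ : X₁, ⋂ x : X₁ × X₂, {q : X₁ × X₂ → ℝ | x.1 ≠ ξ → q x = 0} := by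
    ext q; simp
  rw [this]
  refine (isCompact_stdSimplex ℝ (X₁ × X₂)).inter_right (isClosed_iUnion_of_finite fun ξ =>
    isClosed_iInter fun x => ?_)
  by_cases h : x.1 = ξ
  · simp [h]
  · simpa [h] using isClosed_eq (continuous_apply x) continuous_const

/-- The conditions of the outer region for the input distribution `t.1`, when `t.2.1` and `t.2.2`
are the conditional entropies (in nats) of `Y₁` and `Y₂` given `(U, X₁)`. -/
def Channel.SatisfiesBounds (t : (X₁ × X₂ → ℝ) × ℝ × ℝ) (R : ℝ × ℝ) : Prop :=
  R.1 * Real.log 2 ≤ outEnt W.fst t.1 - t.2.1 ∧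
  (R.1 + R.2) * Real.log 2 ≤
    outEnt W.fst t.1 - t.2.1 + (t.2.2 - ∑ x, t.1 x * noiseEnt W.snd x) ∧
  (R.1 + R.2) * Real.log 2 ≤ outEnt W.snd t.1 - ∑ x, t.1 x * noiseEnt W.snd x

/-- The outer region without the constraint that the rates are nonnegative. -/
def Channel.signedRegion : Set (ℝ × ℝ) :=
  {R | ∃ t ∈ convexHull ℝ W.entropyCurve, W.SatisfiesBounds t R}

/-- The witnesses lie in a compact hull, so those of a convergent sequence of rates have a
convergent subsequence, and the bounds are closed conditions. -/
theorem Channel.isClosed_signedRegion : IsClosed W.signedRegion := by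
  have hc : IsCompact (convexHull ℝ W.entropyCurve) := 
    isCompact_convexHull W.isCompact_entropyCurve
  refine isClosed_of_closure_subset fun R hR => ?_
  obtain ⟨r, hr, hlim⟩ := mem_closure_iff_seq_limit.1 hR
  choose t ht hb using hr
  obtain ⟨t₀, ht₀, φ, hφ, hφlim⟩ := hc.tendsto_subseq ht
  refine ⟨t₀, ht₀, ?_⟩
  have hclosed : IsClosed {s : ((X₁ × X₂ → ℝ) × ℝ × ℝ) × ℝ × ℝ | W.SatisfiesBounds s.1 s.2} := by
    have h1 : Continuous (outEnt W.fst) := continuous_outEnt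
    have h2 : Continuous (outEnt W.snd) := continuous_outEnt
    simp only [SatisfiesBounds, Set.ofPred_and]
    refine IsClosed.inter ?_ (IsClosed.inter ?_ ?_) <;>
      refine isClosed_le ?_ ?_ <;> fun_prop
  exact hclosed.mem_of_tendsto (hφlim.prodMk_nhds (hlim.comp hφ.tendsto_atTop))
    (Eventually.of_forall fun n => hb (φ n))

theorem Channel.isOutput_joint {γ : Type*} (p : X₁ × X₂ → ℝ) (V : X₁ × X₂ → γ) :
    IsOutput (W.joint p) W.fst (fun ω => V (ω.1, ω.2.1)) (fun ω => (ω.1, ω.2.1))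
      (fun ω => ω.2.2.1) ∧
    IsOutput (W.joint p) W.snd (fun ω => V (ω.1, ω.2.1)) (fun ω => (ω.1, ω.2.1))
      (fun ω => ω.2.2.2) :=
  ⟨isOutput_of_equiv (Equiv.prodAssoc X₁ X₂ (Y₁ × Y₂)) (r := p) (ξ := id)
    (k := fun x => W.trans x.1 x.2) (fun _ => (W.trans_mem _ _).2) (fun _ _ => rfl) Prod.fst
    (fun _ _ _ => rfl) (fun _ _ => rfl) (fun _ _ => rfl),
  isOutput_of_equiv (Equiv.prodAssoc X₁ X₂ (Y₁ × Y₂)) (r := p) (ξ := id)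
    (k := fun x => W.trans x.1 x.2) (fun _ => (W.trans_mem _ _).2) (fun _ _ => rfl) Prod.snd
    (fun _ _ _ => rfl) (fun _ _ => rfl) (fun _ _ => rfl)⟩

theorem Channel.isOutput_auxJoint {U γ : Type*} [Fintype U] (p : U × X₁ × X₂ → ℝ)
    (V : U × X₁ × X₂ → γ) :
    IsOutput (W.auxJoint p) W.fst (fun ω => V (ω.1, ω.2.1, ω.2.2.1))
      (fun ω => (ω.2.1, ω.2.2.1)) (fun ω => ω.2.2.2.1) ∧
    IsOutput (W.auxJoint p) W.snd (fun ω => V (ω.1, ω.2.1, ω.2.2.1))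
      (fun ω => (ω.2.1, ω.2.2.1)) (fun ω => ω.2.2.2.2) := by
  let e : (U × X₁ × X₂) × (Y₁ × Y₂) ≃ U × X₁ × X₂ × Y₁ × Y₂ :=
    (Equiv.prodAssoc U (X₁ × X₂) (Y₁ × Y₂)).trans
      ((Equiv.refl U).prodCongr (Equiv.prodAssoc X₁ X₂ (Y₁ × Y₂)))
  exact ⟨isOutput_of_equiv e (r := p) (ξ := Prod.snd)
    (k := fun x => W.trans x.1 x.2) (fun _ => (W.trans_mem _ _).2) (fun _ _ => rfl) Prod.fst
    (fun _ _ _ => rfl) (fun _ _ => rfl) (fun _ _ => rfl),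
    isOutput_of_equiv e (r := p) (ξ := Prod.snd)
    (k := fun x => W.trans x.1 x.2) (fun _ => (W.trans_mem _ _).2) (fun _ _ => rfl) Prod.snd
    (fun _ _ _ => rfl) (fun _ _ => rfl) (fun _ _ => rfl)⟩

end Region

/-! ### Marginal laws, and mutual information across a kernel -/

section KernelLaw

variable {Ω α β γ : Type*} [Fintype Ω]

theorem law_of_equiv {A B : Type*} [Fintype A] [Fintype B] (e : A × B ≃ Ω) {p : Ω → ℝ}
    {r : A → ℝ} {k : A → B → ℝ} (hk : ∀ a, ∑ b, k a b = 1)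
    (hp : ∀ a b, p (e (a, b)) = r a * k a b) {X : Ω → α} {X' : A → α}
    (hX : ∀ a b, X (e (a, b)) = X' a) (x : α) : law p X x = law r X' x := by
  classical
  simp only [law_eq_sum, ← Equiv.sum_comp e, Fintype.sum_prod_type, hX, hp]
  refine Finset.sum_congr rfl fun a _ => ?_
  by_cases h : X' a = x
  · simp [h, ← Finset.mul_sum, hk]
  · simp [h]

theorem law_id (p : Ω → ℝ) : law p id = p := by
  classical
  ext ω
  simp [law_eq_sum]

theorem law_comp [Fintype α] (p : Ω → ℝ) (X : Ω → α) (f : α → β) :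
    law p (fun ω => f (X ω)) = law (law p X) f := by
  classical
  ext b
  have := sum_law_mul p X fun a => if f a = b then 1 else 0
  simp only [mul_ite, mul_one, mul_zero] at this
  rw [law_eq_sum, law_eq_sum, this]

variable [Fintype α] [Fintype β]

theorem IsOutput.mutualInfo_eq {p : Ω → ℝ} {K : α → β → ℝ} {V : Ω → Unit} {X : Ω → α} {Y : Ω → β}
    (h : IsOutput p K V X Y) (hp : ∀ ω, 0 ≤ p ω) (hK : ∀ x, ∑ y, K x y = 1) :
    mutualInfo p X Y =
      (outEnt K (law p X) - ∑ x, law p X x * noiseEnt K x) / Real.log 2 := by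
  have h1 : ent p (fun ω => (V ω, X ω, Y ω)) = ent p (fun ω => (X ω, Y ω)) :=
    ent_congr p fun _ _ => by simp
  have h2 : ent p (fun ω => (V ω, X ω)) = ent p X := ent_congr p fun _ _ => by simp
  rw [mutualInfo_eq_ent hp, ← h.ent_out, ← h1, h.ent_eq hK, h2]
  congr 1; ring

end KernelLaw

/-! ### From random variables to the convex hull and back -/

section Region

variable {X₁ X₂ Y₁ Y₂ : Type*} [Fintype X₁] [Fintype X₂] [Fintype Y₁] [Fintype Y₂]
  (W : Channel X₁ X₂ Y₁ Y₂)

theorem Channel.law_joint (p : X₁ × X₂ → ℝ) : law (W.joint p) (fun ω => (ω.1, ω.2.1)) = p := by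
  ext x
  rw [law_of_equiv (Equiv.prodAssoc X₁ X₂ (Y₁ × Y₂)) (r := p)
    (k := fun x => W.trans x.1 x.2) (X' := id) (fun _ => (W.trans_mem _ _).2) (fun _ _ => rfl)
    (fun _ _ => rfl), law_id]

theorem Channel.law_auxJoint {U : Type*} [Fintype U] (p : U × X₁ × X₂ → ℝ) :
    law (W.auxJoint p) (fun ω => (ω.1, ω.2.1, ω.2.2.1)) = p := by
  ext x
  rw [law_of_equiv ((Equiv.prodAssoc U (X₁ × X₂) (Y₁ × Y₂)).trans
      ((Equiv.refl U).prodCongr (Equiv.prodAssoc X₁ X₂ (Y₁ × Y₂)))) (r := p)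
    (k := fun x => W.trans x.2.1 x.2.2) (X' := id) (fun _ => (W.trans_mem _ _).2) (fun _ _ => rfl)
    (fun _ _ => rfl), law_id]

variable {W}

theorem Channel.CognitiveMoreCapable.outEnt_sub_le (hW : W.CognitiveMoreCapable)
    {q : X₁ × X₂ → ℝ} (hq : q ∈ stdSimplex ℝ (X₁ × X₂)) :
    outEnt W.fst q - ∑ x, q x * noiseEnt W.fst x ≤
      outEnt W.snd q - ∑ x, q x * noiseEnt W.snd x := by
  have hp (ω) : 0 ≤ W.joint q ω := mul_nonneg (hq.1 _) ((W.trans_mem _ _).1 _)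
  have h := hW q hq
  obtain ⟨h1, h2⟩ := W.isOutput_joint q fun _ => ()
  have e1 := h1.mutualInfo_eq hp W.sum_fst
  have e2 := h2.mutualInfo_eq hp W.sum_snd
  rw [W.law_joint] at e1 e2
  exact (div_le_div_iff_of_pos_right (Real.log_pos one_lt_two)).1 ((e1.symm.trans_le h).trans_eq e2)

section Letter

variable {Ω γ : Type*} [Fintype Ω] [Fintype γ] {p : Ω → ℝ} {V : Ω → γ} {X : Ω → X₁ × X₂}
  {Z₁ : Ω → Y₁} {Z₂ : Ω → Y₂}

/-- The hypothesis is applied to each conditional input law given V = v and averaged: I(X;Y₁|V) ≤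
I(X;Y₂|V), with H(V) added on both sides. -/
theorem Channel.CognitiveMoreCapable.ent_sub_le (hW : W.CognitiveMoreCapable)
    (hp : ∀ ω, 0 ≤ p ω) (h₁ : IsOutput p W.fst V X Z₁) (h₂ : IsOutput p W.snd V X Z₂) :
    ent p (fun ω => (V ω, Z₁ ω)) - ∑ x, law p X x * noiseEnt W.fst x ≤
      ent p (fun ω => (V ω, Z₂ ω)) - ∑ x, law p X x * noiseEnt W.snd x := by
  have hn (f : X₁ × X₂ → ℝ) : ∑ x, law p X x * f x =
      ∑ v, law p V v * ∑ x, condLaw p V X v x * f x := by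
    simp only [Finset.mul_sum, ← mul_assoc]
    rw [Finset.sum_comm]
    simp only [← Finset.sum_mul, sum_law_mul_condLaw hp]
  rw [h₁.ent_prod_eq hp W.sum_fst, h₂.ent_prod_eq hp W.sum_snd, hn, hn, add_sub_assoc,
    add_sub_assoc, ← Finset.sum_sub_distrib, ← Finset.sum_sub_distrib]
  refine add_le_add_right (Finset.sum_le_sum fun v _ => ?_) _
  rw [← mul_sub, ← mul_sub]
  by_cases h0 : law p V v = 0
  · simp [h0]
  · exact mul_le_mul_of_nonneg_left (hW.outEnt_sub_le (condLaw_mem hp h0)) (law_nonneg hp _ _)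

/-- Since `V` determines X₁, each conditional law given V = v lies over the curve, and the weights
are P(V = v). -/
theorem Channel.mem_convexHull_entropyCurve (hp : ∀ ω, 0 ≤ p ω) (hp1 : ∑ ω, p ω = 1)
    (h₁ : IsOutput p W.fst V X Z₁) (h₂ : IsOutput p W.snd V X Z₂)
    (hX : ∀ ω ω', V ω = V ω' → (X ω).1 = (X ω').1) :
    (law p X, ent p (fun ω => (V ω, Z₁ ω)) - ent p V, ent p (fun ω => (V ω, Z₂ ω)) - ent p V) ∈
      convexHull ℝ W.entropyCurve := by
  rw [h₁.ent_prod_eq hp W.sum_fst, h₂.ent_prod_eq hp W.sum_snd, add_sub_cancel_left,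
    add_sub_cancel_left]
  have := sum_smul_mem_convexHull (s := W.entropyCurve) (w := law p V)
    (z := fun v => (condLaw p V X v, outEnt W.fst (condLaw p V X v),
      outEnt W.snd (condLaw p V X v))) (law_nonneg hp V) ((sum_law p V).trans hp1) (fun v hv => by
      refine ⟨_, ⟨condLaw_mem hp hv, ?_⟩, rfl⟩
      obtain ⟨ω₀, rfl⟩ : ∃ ω, V ω = v := by
        classical
        by_contra! h
        simp [law_eq_sum, h] at hv
      refine ⟨(X ω₀).1, fun x hx => ?_⟩
      have : law p (fun ω => (V ω, X ω)) (V ω₀, x) = 0 := by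
        classical
        rw [law_eq_sum]
        refine Finset.sum_eq_zero fun ω _ => if_neg ?_
        rintro h
        simp only [Prod.mk.injEq] at h
        exact hx (h.2 ▸ hX _ _ h.1)
      rw [condLaw, this, zero_div])
  convert this using 1
  ext x
  · simp [Prod.fst_sum, sum_law_mul_condLaw hp]
  · simp [Prod.fst_sum, Prod.snd_sum]
  · simp [Prod.snd_sum]

end Letter

/-- The index of the convex combination serves as U, with p(u,x₁,x₂) = w(u) q_u(x₁,x₂). As X₁ = ξ(u)
almost surely under q_u, conditioning on (U,X₁) is conditioning on U. -/
theorem Channel.mem_outerRegion {R : ℝ × ℝ} (h1 : 0 ≤ R.1) (h2 : 0 ≤ R.2)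
    (hR : R ∈ W.signedRegion) : R ∈ W.outerRegion := by
  classical
  obtain ⟨t, ht, hb⟩ := hR
  obtain ⟨w, hw, z, hz, rfl⟩ := exists_fin_of_mem_convexHull ht
  choose q hq hqz using hz
  choose hq ξ hξ using hq
  obtain rfl : (fun i => (q i, outEnt W.fst (q i), outEnt W.snd (q i))) = z := funext hqz
  set p : Fin _ × X₁ × X₂ → ℝ := fun t => w t.1 * q t.1 t.2 with hpdef
  have hp0 (t) : 0 ≤ p t := mul_nonneg (hw.1 _) ((hq _).1 _)
  have hp1 : ∑ t, p t = 1 := by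
    rw [Fintype.sum_prod_type]
    simp only [hpdef, ← Finset.mul_sum, (hq _).2, mul_one, hw.2]
  have hP (ω) : 0 ≤ W.auxJoint p ω := mul_nonneg (hp0 _) ((W.trans_mem _ _).1 _)
  set V : Fin (Module.finrank ℝ ((X₁ × X₂ → ℝ) × ℝ × ℝ) + 1) × X₁ × X₂ × Y₁ × Y₂ → _ × X₁ :=
    fun ω => (ω.1, ω.2.1) with hV
  set X : Fin (Module.finrank ℝ ((X₁ × X₂ → ℝ) × ℝ × ℝ) + 1) × X₁ × X₂ × Y₁ × Y₂ → X₁ × X₂ :=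
    fun ω => (ω.2.1, ω.2.2.1) with hX
  have hlawX : law (W.auxJoint p) X = ∑ i, w i • q i := by
    have := law_comp (W.auxJoint p) (fun ω => (ω.1, ω.2.1, ω.2.2.1)) Prod.snd
    rw [W.law_auxJoint] at this
    refine this.trans ?_
    ext x
    simp [law_eq_sum, Fintype.sum_prod_type, hpdef]
  have hlawV (u) (x) : law (W.auxJoint p) V (u, x) = if x = ξ u then w u else 0 := by
    have := law_comp (W.auxJoint p) (fun ω => (ω.1, ω.2.1, ω.2.2.1)) (fun t => (t.1, t.2.1))
    rw [W.law_auxJoint] at this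
    refine (congrFun this _).trans ?_
    simp only [law_eq_sum, Fintype.sum_prod_type, hpdef, Prod.mk.injEq, ite_and]
    rw [Finset.sum_eq_single u (fun v _ hv => by simp [hv]) (by simp),
      Finset.sum_eq_single x (fun v _ hv => by simp [hv]) (by simp)]
    simp only [if_true, ← Finset.mul_sum]
    split_ifs with hx
    · have := (hq u).2
      rw [Fintype.sum_prod_type, Finset.sum_eq_single (ξ u)
        (fun v _ hv => Finset.sum_eq_zero fun y _ => hξ u (v, y) hv) (by simp)] at this
      rw [hx, this, mul_one]
    · rw [Finset.sum_eq_zero fun y _ => hξ u (x, y) hx, mul_zero]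
  have hlawVX (u) (x) : law (W.auxJoint p) (fun ω => (V ω, X ω)) ((u, ξ u), x) = w u * q u x := by
    have := law_comp (W.auxJoint p) (fun ω => (ω.1, ω.2.1, ω.2.2.1))
      (fun t => ((t.1, t.2.1), t.2))
    rw [W.law_auxJoint] at this
    refine (congrFun this _).trans ?_
    obtain ⟨x, y⟩ := x
    simp only [law_eq_sum, Fintype.sum_prod_type, hpdef, Prod.mk.injEq, ite_and]
    rw [Finset.sum_eq_single u (fun v _ hv => by simp [hv]) (by simp),
      Finset.sum_eq_single x (fun v _ hv => by simp [hv]) (by simp),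
      Finset.sum_eq_single y (fun v _ hv => by simp [hv]) (by simp)]
    simp only [if_true]
    split_ifs with hx
    · rfl
    · rw [hξ u (x, y) hx, mul_zero]
  -- Only the pairs (u, ξ(u)) carry mass, so averages over (U,X₁) collapse to averages over U.
  have hsum (F : (X₁ × X₂ → ℝ) → ℝ) : ∑ v, law (W.auxJoint p) V v *
      F (condLaw (W.auxJoint p) V X v) = ∑ u, w u * F (q u) := by
    rw [Fintype.sum_prod_type]
    refine Finset.sum_congr rfl fun u _ => ?_
    rw [Finset.sum_eq_single (ξ u) (fun x _ hx => by rw [hlawV, if_neg hx, zero_mul]) (by simp),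
      hlawV, if_pos rfl]
    by_cases h0 : w u = 0
    · simp [h0]
    congr 2
    ext x
    rw [condLaw, hlawVX, hlawV, if_pos rfl, mul_div_cancel_left₀ _ h0]
  obtain ⟨o1, o2⟩ := W.isOutput_auxJoint p (fun t => (t.1, t.2.1))
  obtain ⟨-, o3⟩ := W.isOutput_auxJoint p (fun t => ())
  have i1 : mutualInfo (W.auxJoint p) V (fun ω => ω.2.2.2.1) =
      (outEnt W.fst (∑ i, w i • q i) - ∑ i, w i * outEnt W.fst (q i)) / Real.log 2 := by
    rw [mutualInfo_eq_ent hP, o1.ent_prod_eq hP W.sum_fst, o1.ent_out, hsum, hlawX]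
    congr 1; ring
  have i2 : condMutualInfo (W.auxJoint p) (fun ω => ω.2.2.1) (fun ω => ω.2.2.2.2) V =
      (∑ i, w i * outEnt W.snd (q i) - ∑ x, (∑ i, w i • q i) x * noiseEnt W.snd x) /
        Real.log 2 := by
    have e1 : ent (W.auxJoint p) (fun ω => (ω.2.2.1, V ω)) =
        ent (W.auxJoint p) (fun ω => (V ω, X ω)) :=
      ent_congr _ fun ω ω' => by simp [hV, hX]; tauto
    have e2 : ent (W.auxJoint p) (fun ω => (ω.2.2.1, ω.2.2.2.2, V ω)) =
        ent (W.auxJoint p) (fun ω => (V ω, X ω, ω.2.2.2.2)) :=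
      ent_congr _ fun ω ω' => by simp [hV, hX]; tauto
    have e3 : ent (W.auxJoint p) (fun ω => (ω.2.2.2.2, V ω)) =
        ent (W.auxJoint p) (fun ω => (V ω, ω.2.2.2.2)) :=
      ent_congr _ fun ω ω' => by simp [hV]; tauto
    rw [condMutualInfo_eq_ent hP, e1, e2, e3, o2.ent_prod_eq hP W.sum_snd, o2.ent_eq W.sum_snd,
      hsum, hlawX]
    congr 1; ring
  have i3 := o3.mutualInfo_eq hP W.sum_snd
  change mutualInfo _ X _ = (outEnt _ (law _ X) - ∑ x, law _ X x * _) / _ at i3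
  rw [hlawX] at i3
  obtain ⟨b1, b2, b3⟩ := hb
  simp only [Prod.fst_sum, Prod.snd_sum, Prod.smul_fst, Prod.smul_snd, smul_eq_mul] at b1 b2 b3
  have hl := Real.log_pos one_lt_two
  refine ⟨h1, h2, _, p, ⟨hp0, hp1⟩, ?_, ?_, ?_⟩
  · exact ((le_div_iff₀ hl).2 b1).trans_eq i1.symm
  · refine ((le_div_iff₀ hl).2 b2).trans_eq ?_
    rw [add_div]
    exact congrArg₂ _ i1.symm i2.symm
  · exact ((le_div_iff₀ hl).2 b3).trans_eq i3.symm

end Region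

/-! ### Entropies of sequences of random variables -/

section Sequences

/-- The sequence `y` with the entries outside `s` erased. -/
def mask {ι β : Type*} (s : Set ι) (y : ι → β) : ι → Option β := by
  classical exact fun j => if j ∈ s then some (y j) else none

theorem mask_eq_mask {ι β : Type*} {s : Set ι} {y y' : ι → β} :
    mask s y = mask s y' ↔ ∀ j ∈ s, y j = y' j := by
  classical
  rw [funext_iff]
  refine forall_congr' fun j => ?_
  by_cases h : j ∈ s <;> simp [mask, h]

variable {Ω α β γ δ : Type*} [Fintype Ω] {n : ℕ}
  {p : Ω → ℝ} {M : Ω → γ} {A : Ω → Fin n → α} {B : Ω → Fin n → β}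

/-- The variable `M` together with the entries of `A` before position `i`. -/
def past (M : Ω → γ) (A : Ω → Fin n → α) (i : ℕ) (ω : Ω) : γ × (Fin n → Option α) :=
  (M ω, mask {j | j.1 < i} (A ω))

/-- The variable `M` together with the entries of `A` before and of `B` after position `i`. -/
def pastFuture (M : Ω → γ) (A : Ω → Fin n → α) (B : Ω → Fin n → β) (i : Fin n) (ω : Ω) :
    γ × (Fin n → Option α) × (Fin n → Option β) :=
  (M ω, mask {j | j < i} (A ω), mask {j | i < j} (B ω))

/-- The chain rule: a past together with the current entry is the next past, so the sum telescopes.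
-/
theorem ent_prod_sub_ent (p : Ω → ℝ) (M : Ω → γ) (A : Ω → Fin n → α) :
    ent p (fun ω => (M ω, A ω)) - ent p M =
      ∑ i : Fin n, (ent p (fun ω => (past M A i ω, A ω i)) - ent p (past M A i)) := by
  have h (i : Fin n) : ent p (fun ω => (past M A i ω, A ω i)) = ent p (past M A (i.1 + 1)) := by
    refine ent_congr p fun ω ω' => ?_
    simp only [past, Prod.mk.injEq, mask_eq_mask, Set.mem_ofPred_eq, and_assoc]
    refine and_congr_right fun _ => ⟨fun h j hj => ?_, fun h => ⟨fun j hj => h j (by omega),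
      h i (by omega)⟩⟩
    rcases Nat.lt_succ_iff_lt_or_eq.1 hj with hj | hj
    · exact h.1 j hj
    · rw [Fin.ext hj]; exact h.2
  simp only [h]
  rw [Fin.sum_univ_eq_sum_range (fun i => ent p (past M A (i + 1)) - ent p (past M A i)),
    Finset.sum_range_sub fun i => ent p (past M A i)]
  congr 1 <;> refine ent_congr p fun ω ω' => ?_ <;>
    simp only [past, Prod.mk.injEq, mask_eq_mask] <;> simp [funext_iff]

theorem ent_le_sum [Fintype α] (hp : ∀ ω, 0 ≤ p ω) (hp1 : ∑ ω, p ω = 1) (A : Ω → Fin n → α) :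
    ent p A ≤ ∑ i, ent p (fun ω => A ω i) := by
  have h := ent_prod_sub_ent p (fun _ => ()) A
  have h0 : ent p (fun _ => ()) = 0 := ent_of_const hp1 fun _ _ => rfl
  have h1 : ent p (fun ω => ((), A ω)) = ent p A := ent_congr p fun _ _ => by simp
  rw [h1, h0, sub_zero] at h
  rw [h]
  refine Finset.sum_le_sum fun i _ => ?_
  have hs := ent_submodular hp (past (fun _ => ()) A i) (fun ω => A ω i) fun _ => ()
  rw [h0, ent_congr p (Y := fun ω => (past (fun _ => ()) A i ω, A ω i)) (by simp),
    ent_congr p (X := fun ω => (past _ A i ω, ())) (Y := past (fun _ => ()) A i) (by simp),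
    ent_congr p (X := fun ω => (A ω i, ())) (Y := fun ω => A ω i) (by simp)] at hs
  linarith

/-- Conditioning also on the future of `B` can only lower each term of the chain rule. -/
theorem sum_ent_pastFuture_le [Fintype α] [Fintype β] [Fintype γ] (hp : ∀ ω, 0 ≤ p ω) (M : Ω → γ) (A : Ω → Fin n → α)
    (B : Ω → Fin n → β) :
    ∑ i, (ent p (fun ω => (pastFuture M A B i ω, A ω i)) - ent p (pastFuture M A B i)) ≤
      ent p (fun ω => (M ω, A ω)) - ent p M := by
  rw [ent_prod_sub_ent]
  refine Finset.sum_le_sum fun i _ => ?_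
  have hs := ent_submodular hp (fun ω => A ω i) (fun ω => mask {j | i < j} (B ω)) (past M A i)
  rw [ent_congr p (Y := fun ω => (pastFuture M A B i ω, A ω i))
      (fun ω ω' => by simp [past, pastFuture]; tauto),
    ent_congr p (X := fun ω => (mask {j | i < j} (B ω), past M A i ω))
      (Y := pastFuture M A B i) (fun ω ω' => by simp [past, pastFuture]; tauto),
    ent_congr p (X := fun ω => (A ω i, past M A i ω)) (Y := fun ω => (past M A i ω, A ω i))
      (fun ω ω' => by simp; tauto)] at hs
  linarith

/-- A form of the Csiszár sum identity. -/
theorem sum_ent_sub_ent (p : Ω → ℝ) (M : Ω → γ) (A : Ω → Fin n → α) (B : Ω → Fin n → β) :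
    ∑ i, (ent p (fun ω => (pastFuture M A B i ω, B ω i)) -
        ent p (fun ω => (pastFuture M A B i ω, A ω i))) =
      ent p (fun ω => (M ω, B ω)) - ent p (fun ω => (M ω, A ω)) := by
  -- The hybrid takes its first i entries from `A` and the rest from `B`. Adjoining `B ω i` to
  -- `pastFuture` gives hybrid i, adjoining `A ω i` gives hybrid i + 1; the sum telescopes from
  -- (M,B) to (M,A).
  set hyb : ℕ → Ω → γ × (Fin n → Option α) × (Fin n → Option β) := fun i ω =>
    (M ω, mask {j | j.1 < i} (A ω), mask {j | i ≤ j.1} (B ω)) with hhyb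
  have hB (i : Fin n) : ent p (fun ω => (pastFuture M A B i ω, B ω i)) = ent p (hyb i) := by
    refine ent_congr p fun ω ω' => ?_
    simp only [pastFuture, hhyb, Prod.mk.injEq, mask_eq_mask, Set.mem_ofPred_eq, and_assoc]
    refine and_congr_right fun _ => and_congr_right fun _ => ⟨fun h j hj => ?_,
      fun h => ⟨fun j hj => h j (le_of_lt hj), h i le_rfl⟩⟩
    rcases hj.lt_or_eq with hj | hj
    · exact h.1 j hj
    · rw [← Fin.ext hj]; exact h.2
  have hA (i : Fin n) : ent p (fun ω => (pastFuture M A B i ω, A ω i)) =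
      ent p (hyb (i.1 + 1)) := by
    refine ent_congr p fun ω ω' => ?_
    simp only [pastFuture, hhyb, Prod.mk.injEq, mask_eq_mask, Set.mem_ofPred_eq, and_assoc]
    refine and_congr_right fun _ => ⟨fun h => ⟨fun j hj => ?_, fun j hj => h.2.1 j hj⟩,
      fun h => ⟨fun j hj => h.1 j (Nat.lt_succ_of_lt hj), fun j hj => h.2 j hj,
        h.1 i (Nat.lt_succ_self _)⟩⟩
    rcases Nat.lt_succ_iff_lt_or_eq.1 hj with hj | hj
    · exact h.1 j hj
    · rw [Fin.ext hj]; exact h.2.2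
  simp only [hA, hB]
  rw [Fin.sum_univ_eq_sum_range (fun i => ent p (hyb i) - ent p (hyb (i + 1))),
    Finset.sum_range_sub']
  have hlast (j : Fin n) : ¬ n ≤ j.1 := by omega
  congr 1 <;> refine ent_congr p fun ω ω' => ?_ <;>
    simp only [hhyb, Prod.mk.injEq, mask_eq_mask] <;> simp [funext_iff, hlast]

/-- As the inputs are functions of `M`, each chain-rule term is the noise entropy at that time. -/
theorem ent_prod_eq_of_isOutput [Fintype α] [Fintype γ] [Fintype δ] {K : δ → α → ℝ} {X : Fin n → Ω → δ}
    (hK : ∀ x, ∑ y, K x y = 1) (hX : ∀ i ω ω', M ω = M ω' → X i ω = X i ω')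
    (h : ∀ i : Fin n, IsOutput p K (past M A i) (X i) (fun ω => A ω i)) :
    ent p (fun ω => (M ω, A ω)) = ent p M + ∑ i, ∑ x, law p (X i) x * noiseEnt K x := by
  rw [← sub_eq_iff_eq_add', ent_prod_sub_ent]
  refine Finset.sum_congr rfl fun i _ => ?_
  have hi := (h i).ent_eq hK
  have hX' (ω ω') (h : past M A i ω = past M A i ω') : X i ω = X i ω' :=
    hX i ω ω' (congrArg Prod.fst h)
  rw [ent_congr p (Y := fun ω => (past M A i ω, A ω i)) fun ω ω' => by
      simp only [Prod.mk.injEq]; exact ⟨fun h => ⟨h.1, h.2.2⟩, fun h => ⟨h.1, hX' _ _ h.1, h.2⟩⟩,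
    ent_congr p (X := fun ω => (past M A i ω, X i ω)) (Y := past M A i) fun ω ω' => by
      simp only [Prod.mk.injEq]; exact ⟨fun h => h.1, fun h => ⟨h, hX' _ _ h⟩⟩] at hi
  rw [hi, add_sub_cancel_left]

end Sequences

/-! ### The distribution induced by a code -/

section Code

variable {X₁ X₂ Y₁ Y₂ : Type*} [Fintype Y₁] [Fintype Y₂]
  (W : Channel X₁ X₂ Y₁ Y₂) {k₁ k₂ n : ℕ} (c : Code X₁ X₂ Y₁ Y₂ k₁ k₂ n)

/-- The channel inputs at time `i`. -/
def Code.input (i : Fin n) (m : Fin k₁ × Fin k₂) : X₁ × X₂ :=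
  (c.enc₁ m.1 i, c.enc₂ m.1 m.2 i)

theorem Code.joint_nonneg (ω) : 0 ≤ c.joint W ω :=
  mul_nonneg (by positivity) (Finset.prod_nonneg fun _ _ => (W.trans_mem _ _).1 _)

theorem Code.law_messages (m) :
    law (c.joint W) (fun ω => (ω.1, ω.2.1)) m = 1 / ((k₁ : ℝ) * (k₂ : ℝ)) := by
  classical
  rw [law_of_equiv (((Equiv.refl (Fin k₁ × Fin k₂)).prodCongr
      (Equiv.arrowProdEquivProdArrow (Fin n) (fun _ => Y₁) fun _ => Y₂)).trans
        (Equiv.prodAssoc _ _ _)) (r := fun _ => 1 / ((k₁ : ℝ) * (k₂ : ℝ)))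
    (k := fun m z => ∏ i, W.trans (c.enc₁ m.1 i) (c.enc₂ m.1 m.2 i) (z i)) (X' := id)
    (fun m => ?_) (fun _ _ => rfl) (fun _ _ => rfl), law_id]
  have := Finset.prod_univ_sum (fun _ : Fin n => (Finset.univ : Finset (Y₁ × Y₂)))
    fun i b => W.trans (c.enc₁ m.1 i) (c.enc₂ m.1 m.2 i) b
  rw [Fintype.piFinset_univ] at this
  rw [← this]
  exact Finset.prod_eq_one fun i _ => (W.trans_mem _ _).2

variable {W c}

/-- Without memory or feedback, the factor of time i splits off the product. Hence `V` may contain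
outputs from both the past and the future of i. -/
theorem Code.isOutput_input {γ : Type*} (i : Fin n)
    {V : Fin k₁ × Fin k₂ × (Fin n → Y₁) × (Fin n → Y₂) → γ}
    (hV : ∀ ω ω', ω.1 = ω'.1 → ω.2.1 = ω'.2.1 → (∀ j ≠ i, ω.2.2.1 j = ω'.2.2.1 j) →
      (∀ j ≠ i, ω.2.2.2 j = ω'.2.2.2 j) → V ω = V ω') :
    IsOutput (c.joint W) W.fst V (fun ω => c.input i (ω.1, ω.2.1)) (fun ω => ω.2.2.1 i) ∧
    IsOutput (c.joint W) W.snd V (fun ω => c.input i (ω.1, ω.2.1)) (fun ω => ω.2.2.2 i) := by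
  let g := Equiv.funSplitAt i (Y₁ × Y₂)
  let e : (Fin k₁ × Fin k₂ × ({j // j ≠ i} → Y₁ × Y₂)) × (Y₁ × Y₂) ≃
      Fin k₁ × Fin k₂ × (Fin n → Y₁) × (Fin n → Y₂) :=
    { toFun t := (t.1.1, t.1.2.1, fun j => (g.symm (t.2, t.1.2.2) j).1,
        fun j => (g.symm (t.2, t.1.2.2) j).2)
      invFun ω := ((ω.1, ω.2.1, (g fun j => (ω.2.2.1 j, ω.2.2.2 j)).2),
        (g fun j => (ω.2.2.1 j, ω.2.2.2 j)).1)
      left_inv t := by simp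
      right_inv ω := by simp }
  have gi (b z) : g.symm (b, z) i = b := by simp [g]
  have gj (b z) (j) (hj : j ≠ i) : g.symm (b, z) j = z ⟨j, hj⟩ := by simp [g, hj]
  have hp (a b) : c.joint W (e (a, b)) = (1 / ((k₁ : ℝ) * (k₂ : ℝ)) *
      ∏ j : {j // j ≠ i}, W.trans (c.enc₁ a.1 j) (c.enc₂ a.1 a.2.1 j) (a.2.2 j)) *
      W.trans (c.input i (a.1, a.2.1)).1 (c.input i (a.1, a.2.1)).2 b := by
    change _ * ∏ j, W.trans (c.enc₁ a.1 j) (c.enc₂ a.1 a.2.1 j) (g.symm (b, a.2.2) j) = _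
    rw [Fintype.prod_eq_mul_prod_subtype_ne _ i, gi, mul_assoc, mul_comm (W.trans _ _ b)]
    congr 2
    exact Fintype.prod_congr _ _ fun j => by rw [gj b a.2.2 j.1 j.2]
  have hV' (a b b') : V (e (a, b)) = V (e (a, b')) :=
    hV _ _ rfl rfl (fun j hj => by simp [e, gj _ _ j hj]) fun j hj => by simp [e, gj _ _ j hj]
  exact ⟨isOutput_of_equiv e (ξ := fun a => c.input i (a.1, a.2.1))
      (k := fun x => W.trans x.1 x.2) (fun _ => (W.trans_mem _ _).2) hp Prod.fst hV'
      (fun _ _ => rfl) (fun a b => by simp [e, gi]),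
    isOutput_of_equiv e (ξ := fun a => c.input i (a.1, a.2.1))
      (k := fun x => W.trans x.1 x.2) (fun _ => (W.trans_mem _ _).2) hp Prod.snd hV'
      (fun _ _ => rfl) (fun a b => by simp [e, gi])⟩

end Code

theorem prob_mono {Ω : Type*} [Fintype Ω] {p : Ω → ℝ} (hp : ∀ ω, 0 ≤ p ω) {s t : Set Ω}
    (h : s ⊆ t) : prob p s ≤ prob p t :=
  Finset.sum_le_sum fun ω _ => Set.indicator_le_indicator_of_subset h hp ω

theorem ent_of_uniform {Ω α : Type*} [Fintype Ω] [Fintype α] {p : Ω → ℝ} {X : Ω → α} {k : ℝ}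
    (hk : Fintype.card α = k) (hk0 : k ≠ 0) (h : ∀ a, law p X a = 1 / k) :
    ent p X = Real.log k := by
  simp only [ent_eq_sum, h, Finset.sum_const, Finset.card_univ, nsmul_eq_mul, hk,
    Real.negMulLog, one_div, Real.log_inv]
  field_simp

/-! ### The converse for codes -/

section Converse

variable {X₁ X₂ Y₁ Y₂ : Type*} [Fintype Y₁] [Fintype Y₂]
  {W : Channel X₁ X₂ Y₁ Y₂} {k₁ k₂ n : ℕ}

theorem Code.sum_joint (c : Code X₁ X₂ Y₁ Y₂ k₁ k₂ n) (h₁ : 0 < k₁) (h₂ : 0 < k₂) :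
    ∑ ω, c.joint W ω = 1 := by
  have h₁' : (k₁ : ℝ) ≠ 0 := by positivity
  have h₂' : (k₂ : ℝ) ≠ 0 := by positivity
  rw [← sum_law (c.joint W) fun ω => (ω.1, ω.2.1)]
  simp only [c.law_messages, Finset.sum_const, Finset.card_univ, Fintype.card_prod,
    Fintype.card_fin, nsmul_eq_mul]
  push_cast
  field_simp

theorem Code.law_fst (c : Code X₁ X₂ Y₁ Y₂ k₁ k₂ n) (h₂ : 0 < k₂) (m) :
    law (c.joint W) (fun ω => ω.1) m = 1 / (k₁ : ℝ) := by
  have h₂' : (k₂ : ℝ) ≠ 0 := by positivity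
  rw [← sum_law_snd _ _ (fun ω => ω.2.1)]
  simp only [c.law_messages, Finset.sum_const, Finset.card_univ, Fintype.card_fin, nsmul_eq_mul]
  field_simp

theorem Code.law_snd (c : Code X₁ X₂ Y₁ Y₂ k₁ k₂ n) (h₁ : 0 < k₁) (m) :
    law (c.joint W) (fun ω => ω.2.1) m = 1 / (k₂ : ℝ) := by
  have h₁' : (k₁ : ℝ) ≠ 0 := by positivity
  rw [← sum_law_fst _ (fun ω => ω.1)]
  simp only [c.law_messages, Finset.sum_const, Finset.card_univ, Fintype.card_fin, nsmul_eq_mul]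
  field_simp

variable [Fintype X₁] [Fintype X₂]

/-- The converse bounds for a code of positive block length. -/
theorem Code.exists_bounds (hW : W.CognitiveMoreCapable) (c : Code X₁ X₂ Y₁ Y₂ k₁ k₂ n)
    (h₁ : 0 < k₁) (h₂ : 0 < k₂) (hn : 0 < n) :
    ∃ t ∈ convexHull ℝ W.entropyCurve,
      (1 - c.errorProb W) * Real.log k₁ - Real.log 2 ≤ n * (outEnt W.fst t.1 - t.2.1) ∧
      (1 - c.errorProb W) * (Real.log k₁ + Real.log k₂) - 2 * Real.log 2 ≤
        n * (outEnt W.fst t.1 - t.2.1 + (t.2.2 - ∑ x, t.1 x * noiseEnt W.snd x)) ∧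
      (1 - c.errorProb W) * (Real.log k₁ + Real.log k₂) - 2 * Real.log 2 ≤
        n * (outEnt W.snd t.1 - ∑ x, t.1 x * noiseEnt W.snd x) := by
  set P := c.joint W
  have hP : ∀ ω, 0 ≤ P ω := c.joint_nonneg W
  have hP1 : ∑ ω, P ω = 1 := c.sum_joint h₁ h₂
  let M₁ : Fin k₁ × Fin k₂ × (Fin n → Y₁) × (Fin n → Y₂) → Fin k₁ := fun ω => ω.1
  let M₂ : Fin k₁ × Fin k₂ × (Fin n → Y₁) × (Fin n → Y₂) → Fin k₂ := fun ω => ω.2.1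
  let M : Fin k₁ × Fin k₂ × (Fin n → Y₁) × (Fin n → Y₂) → Fin k₁ × Fin k₂ :=
    fun ω => (ω.1, ω.2.1)
  let A : Fin k₁ × Fin k₂ × (Fin n → Y₁) × (Fin n → Y₂) → Fin n → Y₁ := fun ω => ω.2.2.1
  let B : Fin k₁ × Fin k₂ × (Fin n → Y₁) × (Fin n → Y₂) → Fin n → Y₂ := fun ω => ω.2.2.2
  let X (i : Fin n) (ω : Fin k₁ × Fin k₂ × (Fin n → Y₁) × (Fin n → Y₂)) : X₁ × X₂ :=
    c.input i (M ω)
  have h₁' : (k₁ : ℝ) ≠ 0 := by positivity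
  have h₂' : (k₂ : ℝ) ≠ 0 := by positivity
  have eM₁ : ent P M₁ = Real.log k₁ := ent_of_uniform (by simp) h₁' (c.law_fst h₂)
  have eM₂ : ent P M₂ = Real.log k₂ := ent_of_uniform (by simp) h₂' (c.law_snd h₁)
  have eM : ent P M = Real.log k₁ + Real.log k₂ := by
    rw [← Real.log_mul h₁' h₂']
    exact ent_of_uniform (by simp) (mul_ne_zero h₁' h₂') (c.law_messages W)
  -- decoding
  have f₁ : ent P (fun ω => (M₁ ω, A ω)) - ent P A ≤
      Real.log 2 + c.errorProb W * Real.log k₁ := by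
    have := ent_sub_ent_le hP hP1 M₁ A c.dec₁
    rw [Fintype.card_fin] at this
    exact this.trans (add_le_add_right (mul_le_mul_of_nonneg_right
      (prob_mono hP fun ω h => Or.inl h) (Real.log_natCast_nonneg _)) _)
  have f₂ : ent P (fun ω => (M₂ ω, B ω)) - ent P B ≤
      Real.log 2 + c.errorProb W * Real.log k₂ := by
    have := ent_sub_ent_le hP hP1 M₂ B c.dec₂
    rw [Fintype.card_fin] at this
    exact this.trans (add_le_add_right (mul_le_mul_of_nonneg_right
      (prob_mono hP fun ω h => Or.inr h) (Real.log_natCast_nonneg _)) _)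
  -- Knowing the other message only helps: H(M₁|M₂,A) ≤ H(M₁|A) and H(M₂|M₁,B) ≤ H(M₂|B).
  have s₁ := ent_submodular hP M₁ M₂ A
  have s₂ := ent_submodular hP M₂ M₁ B
  rw [ent_congr P (Y := fun ω => (M ω, A ω)) (fun ω ω' => by simp [M, M₁, M₂, and_assoc])] at s₁
  rw [ent_congr P (Y := fun ω => (M ω, B ω)) (fun ω ω' => by simp [M, M₁, M₂]; tauto)] at s₂
  -- the channel
  have hXM (i : Fin n) (ω ω') (h : M ω = M ω') : X i ω = X i ω' := congrArg (c.input i) h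
  have oA (i : Fin n) : IsOutput P W.fst (past M A i) (X i) (fun ω => A ω i) :=
    (Code.isOutput_input i fun ω ω' h1 h2 h3 h4 => Prod.ext (Prod.ext h1 h2)
      (mask_eq_mask.2 fun j hj => h3 j (Fin.ne_of_lt hj))).1
  have oB (i : Fin n) : IsOutput P W.snd (past M B i) (X i) (fun ω => B ω i) :=
    (Code.isOutput_input i fun ω ω' h1 h2 h3 h4 => Prod.ext (Prod.ext h1 h2)
      (mask_eq_mask.2 fun j hj => h4 j (Fin.ne_of_lt hj))).2
  have eA := ent_prod_eq_of_isOutput W.sum_fst hXM oA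
  have eB := ent_prod_eq_of_isOutput W.sum_snd hXM oB
  have o₁ (i : Fin n) : IsOutput P W.fst (pastFuture M₁ A B i) (X i) (fun ω => A ω i) ∧
      IsOutput P W.snd (pastFuture M₁ A B i) (X i) (fun ω => B ω i) :=
    Code.isOutput_input i fun ω ω' h1 h2 h3 h4 => Prod.ext h1 (Prod.ext
      (mask_eq_mask.2 fun j hj => h3 j (ne_of_lt hj))
      (mask_eq_mask.2 fun j hj => h4 j (ne_of_gt hj)))
  have o₂ (i : Fin n) : IsOutput P W.fst (pastFuture M₂ A B i) (X i) (fun ω => A ω i) ∧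
      IsOutput P W.snd (pastFuture M₂ A B i) (X i) (fun ω => B ω i) :=
    Code.isOutput_input i fun ω ω' h1 h2 h3 h4 => Prod.ext h2 (Prod.ext
      (mask_eq_mask.2 fun j hj => h3 j (ne_of_lt hj))
      (mask_eq_mask.2 fun j hj => h4 j (ne_of_gt hj)))
  -- More capability is used only here, conditionally on M₂ with the past of `A` and the future of
  -- `B`.
  have mc := Finset.sum_le_sum fun i (_ : i ∈ Finset.univ) =>
    hW.ent_sub_le hP (o₂ i).1 (o₂ i).2
  rw [Finset.sum_sub_distrib, Finset.sum_sub_distrib] at mc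
  have cs₁ := sum_ent_sub_ent P M₁ A B
  have cs₂ := sum_ent_sub_ent P M₂ A B
  rw [Finset.sum_sub_distrib] at cs₁ cs₂
  have pf := sum_ent_pastFuture_le hP M₁ A B
  have hn' : (n : ℝ) ≠ 0 := by positivity
  -- averaging over time
  set a : Fin n → ℝ := fun i =>
    ent P (fun ω => (pastFuture M₁ A B i ω, A ω i)) - ent P (pastFuture M₁ A B i) with ha
  set b : Fin n → ℝ := fun i =>
    ent P (fun ω => (pastFuture M₁ A B i ω, B ω i)) - ent P (pastFuture M₁ A B i) with hb
  have hab : ∑ i, b i - ∑ i, a i =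
      ent P (fun ω => (M₁ ω, B ω)) - ent P (fun ω => (M₁ ω, A ω)) := by
    rw [← cs₁, ha, hb, Finset.sum_sub_distrib, Finset.sum_sub_distrib]; ring
  have hw1 : ∑ _i : Fin n, (1 / n : ℝ) = 1 := by simp [hn']
  have hw0 : ∀ _i : Fin n, (0 : ℝ) ≤ 1 / n := fun _ => by positivity
  set q : X₁ × X₂ → ℝ := ∑ i, (1 / n : ℝ) • law P (X i) with hq
  have hmem : (q, (1 / n : ℝ) * ∑ i, a i, (1 / n : ℝ) * ∑ i, b i) ∈
      convexHull ℝ W.entropyCurve := by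
    have := (convex_convexHull ℝ W.entropyCurve).sum_mem (t := Finset.univ)
      (w := fun _ : Fin n => (1 / n : ℝ)) (z := fun i => (law P (X i), a i, b i))
      (fun i _ => hw0 i) hw1 fun i _ => Channel.mem_convexHull_entropyCurve hP hP1
        (o₁ i).1 (o₁ i).2 fun ω ω' h => by
          have : M₁ ω = M₁ ω' := (Prod.ext_iff.1 h).1
          exact congrArg (fun m => c.enc₁ m i) this
    convert this using 1
    ext x
    · simp [hq, Prod.fst_sum]
    · simp [Prod.fst_sum, Prod.snd_sum, Finset.mul_sum]
    · simp [Prod.snd_sum, Finset.mul_sum]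
  have hA : ent P A ≤ n * outEnt W.fst q := by
    refine (ent_le_sum hP hP1 A).trans ?_
    have : ∑ i, (1 / n : ℝ) * outEnt W.fst (law P (X i)) ≤ outEnt W.fst q :=
      outEnt_concave W.fst_nonneg hw0 hw1 fun i => law_nonneg hP (X i)
    rw [← Finset.mul_sum, one_div, inv_mul_le_iff₀ (by positivity)] at this
    simpa only [(o₁ _).1.ent_out] using this
  have hB : ent P B ≤ n * outEnt W.snd q := by
    refine (ent_le_sum hP hP1 B).trans ?_
    have : ∑ i, (1 / n : ℝ) * outEnt W.snd (law P (X i)) ≤ outEnt W.snd q :=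
      outEnt_concave W.snd_nonneg hw0 hw1 fun i => law_nonneg hP (X i)
    rw [← Finset.mul_sum, one_div, inv_mul_le_iff₀ (by positivity)] at this
    simpa only [(o₁ _).2.ent_out] using this
  have hnoise : (n : ℝ) * ∑ x, q x * noiseEnt W.snd x =
      ∑ i, ∑ x, law P (X i) x * noiseEnt W.snd x := by
    rw [Finset.sum_comm, Finset.mul_sum]
    refine Finset.sum_congr rfl fun x _ => ?_
    simp only [hq, Finset.sum_apply, Pi.smul_apply, smul_eq_mul, ← Finset.mul_sum,
      ← Finset.sum_mul]
    field_simp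
  have hna (s : ℝ) : (n : ℝ) * (1 / n * s) = s := by field_simp
  refine ⟨_, hmem, ?_, ?_, ?_⟩
  -- I(M₁;A) ≤ H(A) - ∑ a, by `pf`.
  · simp only [mul_sub, hna]
    linarith
  -- I(M₁;A) + I(M₂;B|M₁) = H(A) - ∑ a + ∑ b - H(B|M), by `hab`; `eB` evaluates H(B|M).
  · simp only [mul_sub, mul_add, hna, hnoise]
    linarith
  -- I(M₂;B) + I(M₁;A|M₂) = H(B) + H(M₂,A) - H(M₂,B) - H(A|M), which `cs₂` and `mc` bound by H(B) -
  -- H(B|M).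
  · simp only [mul_sub, hnoise]
    linarith

/-- The pairs (1 - ε)R - (1/n, 1/n) absorb Fano's loss of one bit per message and tend to R. They
may have negative entries, so the region used here does not require nonnegative rates. -/
theorem Channel.Achievable.mem_signedRegion (hW : W.CognitiveMoreCapable) {R : ℝ × ℝ}
    (hR : W.Achievable R) : R ∈ W.signedRegion := by
  obtain ⟨-, -, c, hc⟩ := hR
  have hlim : Tendsto (fun n : ℕ => ((1 - (c n).errorProb W) * R.1 - 1 / n,
      (1 - (c n).errorProb W) * R.2 - 1 / n)) atTop (𝓝 R) := by
    have h1 (r : ℝ) : Tendsto (fun n : ℕ => (1 - (c n).errorProb W) * r - 1 / n) atTop (𝓝 r) := by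
      have := ((tendsto_const_nhds (x := (1 : ℝ))).sub hc).mul_const r |>.sub
        tendsto_one_div_atTop_nhds_zero_nat
      simpa using this
    exact (h1 R.1).prodMk_nhds (h1 R.2)
  refine W.isClosed_signedRegion.mem_of_tendsto hlim ?_
  filter_upwards [eventually_gt_atTop 0] with n hn
  have hpos (r : ℝ) : 0 < ⌈(2 : ℝ) ^ ((n : ℝ) * r)⌉₊ := Nat.ceil_pos.2 (by positivity)
  have hlog (r : ℝ) : n * r * Real.log 2 ≤ Real.log ⌈(2 : ℝ) ^ ((n : ℝ) * r)⌉₊ := by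
    rw [← Real.log_rpow two_pos]
    exact Real.log_le_log (by positivity) (Nat.le_ceil _)
  have hε : 0 ≤ 1 - (c n).errorProb W := by
    have := prob_mono ((c n).joint_nonneg W) (Set.subset_univ
      {(m₁, m₂, y₁, y₂) | (c n).dec₁ y₁ ≠ m₁ ∨ (c n).dec₂ y₂ ≠ m₂})
    rw [prob, prob, Set.indicator_univ, (c n).sum_joint (hpos _) (hpos _)] at this
    exact sub_nonneg.2 this
  obtain ⟨t, ht, b1, b2, b3⟩ := (c n).exists_bounds hW (hpos _) (hpos _) hn
  have hn' : (0 : ℝ) < n := by exact_mod_cast hn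
  have m1 := mul_le_mul_of_nonneg_left (hlog R.1) hε
  have m2 := mul_le_mul_of_nonneg_left (hlog R.2) hε
  refine ⟨t, ht, ?_, ?_, ?_⟩
  · refine le_of_mul_le_mul_left (le_trans ?_ b1) hn'
    have : (n : ℝ) * (((1 - (c n).errorProb W) * R.1 - 1 / n) * Real.log 2) =
        (1 - (c n).errorProb W) * (n * R.1 * Real.log 2) - Real.log 2 := by field_simp
    linarith
  all_goals
    have : (n : ℝ) * (((1 - (c n).errorProb W) * R.1 - 1 / n +
        ((1 - (c n).errorProb W) * R.2 - 1 / n)) * Real.log 2) =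
        (1 - (c n).errorProb W) * (n * R.1 * Real.log 2) +
          (1 - (c n).errorProb W) * (n * R.2 * Real.log 2) - 2 * Real.log 2 := by
      field_simp; ring
  · refine le_of_mul_le_mul_left (le_trans ?_ b2) hn'
    linarith
  · refine le_of_mul_le_mul_left (le_trans ?_ b3) hn'
    linarith

end Converse

end DMCIC

end

/-- The capacity region of a cognitive-more-capable discrete memoryless cognitive interference
channel is contained in the outer region. -/
theorem theorem1 {X₁ X₂ Y₁ Y₂ : Type*} [Fintype X₁] [Fintype X₂] [Fintype Y₁] [Fintype Y₂]
    (W : DMCIC.Channel X₁ X₂ Y₁ Y₂) (hW : W.CognitiveMoreCapable) :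
    W.capacityRegion ⊆ W.outerRegion := by
  intro R hR
  have hnonneg : IsClosed {R : ℝ × ℝ | 0 ≤ R.1 ∧ 0 ≤ R.2} :=
    (isClosed_le continuous_const continuous_fst).inter (isClosed_le continuous_const continuous_snd)
  have h := closure_minimal (show {R | W.Achievable R} ⊆ {R : ℝ × ℝ | 0 ≤ R.1 ∧ 0 ≤ R.2} from
    fun R h => ⟨h.1, h.2.1⟩) hnonneg hR
  exact W.mem_outerRegion h.1 h.2 (closure_minimal
    (fun R (h : W.Achievable R) => h.mem_signedRegion hW) W.isClosed_signedRegion hR)
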